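/- Let $D\subsetneq\mathbb{C}$ be a domain, let $z\in D$, and suppose that there is a conformal map $\phi$ from $D$ onto the open unit disk $\mathbb{D}$ with $\phi(z)=0$ (equivalently, $D$ is simply connected); let $C(z,D)=|\phi'(z)|^{-1}$ be the conformal radius of $D$ viewed from $z$. Let $H^1_0(D)$ be the closure of $C_c^\infty(D)$ under the norm of the scalar product $\langle f,g\rangle_\nabla=\frac1{2\pi}\int_D\nabla f\cdot\nabla g$, and let $h=\sum_n a_n e_n$ be a Gaussian Free Field in $D$ with Dirichlet boundary conditions, where $(e_n)$ is an orthonormal basis of $H^1_0(D)$ and the $a_n$ are independent standard Gaussian variables. For $f=\sum_n\alpha_n e_n\in H^1_0(D)$ put $\langle h,f\rangle_\nabla=\sum_n a_n\alpha_n$ (almost sure limit of the partial sums). Let $G^z$ be the Green's function of $D$ with pole $z$, i.e. the function that is harmonic on $D\setminus\{z\}$, tends to $0$ at the boundary of $D$ (taken in the Riemann sphere) and satisfies $G^z(y)\sim\log\frac1{|z-y|}$ as $y\to z$; put $\tilde G^z(y)=G^z(y)-\log\frac1{|z-y|}$, extended continuously to $y=z$, and for $\varepsilon>0$ let $$G^z_\varepsilon(y)=\log\frac1{\max(\varepsilon,|z-y|)}+\tilde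 G^z(y).$$ If $0<\varepsilon\le \mathrm{dist}(z,\partial D)$, then $G^z_\varepsilon\in H^1_0(D)$, the circle average $h_\varepsilon(z):=\langle h,G^z_\varepsilon\rangle_\nabla$ is well defined (the series converges almost surely) and square integrable, and $$\mathrm{Var}\big(h_\varepsilon(z)\big)=\log\frac1\varepsilon+\log C(z,D).$$ -/

import Mathlib

open MeasureTheory ProbabilityTheory Filter Topology TopologicalSpace
open scoped Distributions

noncomputable section

namespace PlanarGFF

/-! ### Conformal maps and the conformal radius -/

/-- `φ` is a conformal map (a biholomorphism) from the set `U` onto the set `V`. -/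
def IsConformalMap (φ : ℂ → ℂ) (U V : Set ℂ) : Prop :=
  DifferentiableOn ℂ φ U ∧ Set.BijOn φ U V

/-- `C` is the conformal radius of `D` viewed from `z`: `C = |φ'(z)|⁻¹` for a conformal map `φ`
from `D` onto the open unit disk with `φ z = 0`. -/
def IsConformalRadius (D : Opens ℂ) (z : ℂ) (C : ℝ) : Prop :=
  ∃ φ : ℂ → ℂ, IsConformalMap φ (D : Set ℂ) (Metric.ball 0 1) ∧ φ z = 0 ∧ C = ‖deriv φ z‖⁻¹

/-! ### The Green's function -/

/-- The properties characterizing `G = G_D(x, ·)` on `D \ {x}` (values elsewhere are irrelevant).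
In `vanishes`, the filter `cocompact D` is the filter of points leaving every compact subset
of `D`, i.e. tending to the boundary of `D` in the Riemann sphere. -/
structure IsGreenFunction (D : Opens ℂ) (x : ℂ) (G : ℂ → ℝ) : Prop where
  harmonic : InnerProductSpace.HarmonicOnNhd G ((D : Set ℂ) \ {x})
  vanishes : Tendsto (fun y : D => G y) (cocompact D) (𝓝 0)
  singularity : Asymptotics.IsEquivalent (𝓝[≠] x) G (fun y => Real.log (1 / ‖x - y‖))

open Classical in
/-- The Green's function `G^x(y) = G_D(x, y)`. -/
def greenFunction (D : Opens ℂ) (x : ℂ) : ℂ → ℝ :=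
  if h : ∃ G, IsGreenFunction D x G then h.choose else 0

/-- The harmonic correction `G̃^x(y) = G^x(y) - log (1 / |x - y|)`, extended by continuity
at `y = x`. -/
def greenCorrection (D : Opens ℂ) (x : ℂ) : ℂ → ℝ :=
  Function.update (fun y => greenFunction D x y - Real.log (1 / ‖x - y‖)) x
    (limUnder (𝓝[≠] x) (fun y => greenFunction D x y - Real.log (1 / ‖x - y‖)))

/-- The regularized Green's function `G_ε^x(y) = log (1 / (ε ∨ |x - y|)) + G̃^x(y)`. -/
def regGreen (D : Opens ℂ) (ε : ℝ) (x : ℂ) (y : ℂ) : ℝ :=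
  Real.log (1 / max ε ‖x - y‖) + greenCorrection D x y

/-! ### The Sobolev space `H¹₀(D)` -/

/-- Lebesgue measure on `D` divided by `2π`, so that the inner product of its `L²` space is
`(1 / 2π) ∫_D u · v`. -/
def dirichletMeasure (D : Opens ℂ) : Measure ℂ :=
  ENNReal.ofReal (2 * Real.pi)⁻¹ • volume.restrict (D : Set ℂ)

theorem memLp_gradient (D : Opens ℂ) (f : 𝓓(D, ℝ)) :
    MemLp (fun x => gradient (f : ℂ → ℝ) x) 2 (dirichletMeasure D) := by
  have hf : ContDiff ℝ (⊤ : ℕ∞) (f : ℂ → ℝ) := f.contDiff'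
  have hc : Continuous (fun x => fderiv ℝ (f : ℂ → ℝ) x) :=
    hf.continuous_fderiv (by simp)
  have hs : HasCompactSupport (fun x => fderiv ℝ (f : ℂ → ℝ) x) :=
    f.hasCompactSupport'.fderiv (𝕜 := ℝ)
  have hg : Continuous (fun x => gradient (f : ℂ → ℝ) x) :=
    (InnerProductSpace.toDual ℝ ℂ).symm.continuous.comp hc
  have hgs : HasCompactSupport (fun x => gradient (f : ℂ → ℝ) x) :=
    hs.comp_left (g := (InnerProductSpace.toDual ℝ ℂ).symm) (map_zero _)
  have h : MemLp (fun x => gradient (f : ℂ → ℝ) x) 2 (volume : Measure ℂ) :=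
    hg.memLp_of_hasCompactSupport hgs
  exact (h.restrict _).smul_measure ENNReal.ofReal_ne_top

/-- The gradient of a test function, as a vector field in `L²`. (`ℂ` is used as `ℝ²`.) -/
def gradL2 (D : Opens ℂ) : 𝓓(D, ℝ) →ₗ[ℝ] Lp ℂ 2 (dirichletMeasure D) where
  toFun f := (memLp_gradient D f).toLp _
  map_add' f g := by
    rw [← MemLp.toLp_add]
    congr 1
    funext x
    have hf : DifferentiableAt ℝ (f : ℂ → ℝ) x :=
      (f.contDiff'.differentiable (by simp)) x
    have hg : DifferentiableAt ℝ (g : ℂ → ℝ) x :=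
      (g.contDiff'.differentiable (by simp)) x
    simp only [gradient, Pi.add_apply]
    rw [← map_add, ← fderiv_add hf hg]
    rfl
  map_smul' c f := by
    simp only [RingHom.id_apply]
    rw [← MemLp.toLp_const_smul]
    congr 1
    funext x
    have hf : DifferentiableAt ℝ (f : ℂ → ℝ) x :=
      (f.contDiff'.differentiable (by simp)) x
    simp only [gradient, Pi.smul_apply]
    rw [← map_smul, ← fderiv_const_smul hf]
    rfl

/-- The Hilbert space `H¹₀(D)`, the completion of the smooth compactly supported functions for
the norm `‖f‖² = (1 / 2π) ∫_D |∇f|²`, realized isometrically (through `f ↦ ∇f`) as the closure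
of the space of gradients in `L²`. Its inner product is `⟨f, g⟩ = (1 / 2π) ∫_D ∇f · ∇g`. -/
def H1 (D : Opens ℂ) : Submodule ℝ (Lp ℂ 2 (dirichletMeasure D)) :=
  (LinearMap.range (gradL2 D)).topologicalClosure

/-- The function `f` on `D` is the element `u` of `H¹₀(D)`: some sequence of test functions
converges to `u` in the norm of `H¹₀(D)` and to `f` in `L¹` on every compact subset of `D`. -/
def Represents {D : Opens ℂ} (u : H1 D) (f : ℂ → ℝ) : Prop :=
  ∃ φ : ℕ → 𝓓(D, ℝ),
    Tendsto (fun n => gradL2 D (φ n)) atTop (𝓝 (u : Lp ℂ 2 (dirichletMeasure D))) ∧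
    ∀ K : Set ℂ, IsCompact K → K ⊆ D →
      Tendsto (fun n => ∫⁻ x in K, ‖φ n x - f x‖ₑ) atTop (𝓝 0)

/-- The function `f` on `D` belongs to `H¹₀(D)`. -/
def MemH1 (D : Opens ℂ) (f : ℂ → ℝ) : Prop :=
  ∃ u : H1 D, Represents u f

open Classical in
/-- A function that belongs to `H¹₀(D)`, as an element of that space. -/
def toH1 (D : Opens ℂ) (f : ℂ → ℝ) : H1 D :=
  if h : MemH1 D f then h.choose else 0

/-! ### The Gaussian Free Field -/

/-- A Gaussian Free Field `h = ∑ aₙ eₙ` in `D` with Dirichlet boundary conditions: `(eₙ)` is an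
orthonormal basis of `H¹₀(D)` and the `aₙ` are independent standard Gaussian variables. -/
structure GFF (D : Opens ℂ) {Ω : Type*} [MeasurableSpace Ω] (P : Measure Ω) where
  basis : HilbertBasis ℕ ℝ (H1 D)
  coeff : ℕ → Ω → ℝ
  indep : iIndepFun coeff P
  law : ∀ n, HasLaw (coeff n) (gaussianReal 0 1) P

namespace GFF

variable {D : Opens ℂ} {Ω : Type*} [MeasurableSpace Ω] {P : Measure Ω}

/-- The partial sums of the series `⟨h, f⟩ = ∑ aₙ αₙ`, where `f = ∑ αₙ eₙ` in `H¹₀(D)`. -/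
def partialPairing (h : GFF D P) (f : H1 D) (N : ℕ) (ω : Ω) : ℝ :=
  ∑ n ∈ Finset.range N, h.coeff n ω * h.basis.repr f n

/-- The random variable `⟨h, f⟩ = ∑ aₙ αₙ` (limit of the partial sums). -/
def pairing (h : GFF D P) (f : H1 D) (ω : Ω) : ℝ :=
  limUnder atTop (fun N => h.partialPairing f N ω)

/-- The circle average `h_ε(z) = ⟨h, G_ε^z⟩`. -/
def circleAvg (h : GFF D P) (ε : ℝ) (z : ℂ) : Ω → ℝ :=
  h.pairing (toH1 D (regGreen D ε z))

end GFF

end PlanarGFF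

end

/-! The series `∑ aₙ αₙ` is centred Gaussian with variance `∑ αₙ² = ‖f‖²`, so the point is that the
truncated Green's function lies in `H1 D` and has squared norm `H z - log ε`, where `H` is the
harmonic correction. The conformal map gives the Green's function as `-log |φ|`, hence `H y = -log
|φ y / (y - z)|` and `H z = -log |φ' z| = log C`.

Heuristically `-Δ/2π` of the truncated function is the uniform law on the circle of radius `ε`. Its
squared Dirichlet norm is then its mean over that circle, where it equals `H - log ε`, and the mean
value property gives `H z - log ε`.

The truncated function is neither smooth nor compactly supported, and the circle may touch the
boundary of `D`. It is therefore replaced by test functions `approxGreen`: `logRamp` spreads the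
kink over an annulus strictly inside the ball, and a convex ramp then cuts off the small values.
Convexity makes the extra term in the Laplacian nonnegative, the vanishing of the integral of a
Laplacian bounds its mass by `2π`, and it lives only where the function is small. Thus the inner
product of the test functions with parameters `a` and `b` is within `4a + 4b` of `H z - log ε`
(`abs_integral_add_le`). They converge in `H1 D` to an element of the right norm
(`exists_tendsto_of_inner_tendsto`), and uniform convergence on `D` identifies the limit. Since
`toH1` chooses a representing element, `Represents.unique` is needed to conclude. -/

noncomputable section

namespace PlanarGFF

open Laplacian (laplacian)

/-! ### Injective holomorphic maps: properness and nonvanishing derivative. -/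

namespace IsConformalMap

variable {φ : ℂ → ℂ} {U V : Set ℂ}

theorem analyticAt (h : IsConformalMap φ U V) (hU : IsOpen U) {y : ℂ} (hy : y ∈ U) :
    AnalyticAt ℂ φ y :=
  h.1.analyticAt (hU.mem_nhds hy)

theorem not_eventually_const (h : IsConformalMap φ U V) (hU : IsOpen U) {y : ℂ} (hy : y ∈ U) :
    ¬ ∀ᶠ w in 𝓝 y, φ w = φ y := by
  intro hc
  have h1 : ∀ᶠ w in 𝓝[≠] y, φ w = φ y ∧ w ∈ U ∧ w ≠ y :=
    ((hc.filter_mono nhdsWithin_le_nhds).and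
      (((hU.eventually_mem hy).filter_mono nhdsWithin_le_nhds).and
        eventually_mem_nhdsWithin))
  obtain ⟨w, hw, hwU, hne⟩ := h1.exists
  exact hne (h.2.injOn hwU hy hw)

theorem nhds_le_map (h : IsConformalMap φ U V) (hU : IsOpen U) {y : ℂ} (hy : y ∈ U) :
    𝓝 (φ y) ≤ map φ (𝓝 y) :=
  (h.analyticAt hU hy).eventually_constant_or_nhds_le_map_nhds.resolve_left
    (h.not_eventually_const hU hy)

theorem tendsto_invFunOn (h : IsConformalMap φ U V) (hU : IsOpen U) {y : ℂ} (hy : y ∈ U) :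
    Tendsto (Function.invFunOn φ U) (𝓝 (φ y)) (𝓝 y) := by
  refine (tendsto_map'_iff.2 ?_).mono_left (h.nhds_le_map hU hy)
  refine tendsto_id.congr' ?_
  filter_upwards [hU.mem_nhds hy] with w hw
  exact (h.2.injOn.leftInvOn_invFunOn hw).symm

/-- The inverse is continuous by the open mapping theorem, and the set is the image of `K` under it.
This properness makes `-log |φ|` vanish at the boundary. -/
theorem isCompact_preimage (h : IsConformalMap φ U V) (hU : IsOpen U) {K : Set ℂ}
    (hK : IsCompact K) (hKV : K ⊆ V) : IsCompact (U ∩ φ ⁻¹' K) := by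
  have hc : ContinuousOn (Function.invFunOn φ U) K := by
    intro w hw
    obtain ⟨y, hy, rfl⟩ := h.2.surjOn (hKV hw)
    have := h.tendsto_invFunOn hU hy
    refine ContinuousAt.continuousWithinAt ?_
    rw [ContinuousAt, h.2.injOn.leftInvOn_invFunOn hy]
    exact this
  convert hK.image_of_continuousOn hc using 1
  ext y
  constructor
  · rintro ⟨hy, hyK⟩
    exact ⟨φ y, hyK, h.2.injOn.leftInvOn_invFunOn hy⟩
  · rintro ⟨w, hw, rfl⟩
    obtain ⟨y, hy, rfl⟩ := h.2.surjOn (hKV hw)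
    rw [h.2.injOn.leftInvOn_invFunOn hy]
    exact ⟨hy, hw⟩

/-- Critical points are isolated, so the inverse `ψ` is differentiable on a punctured neighbourhood
of `φ y` and continuous there. The singularity is removable, and the chain rule for `ψ ∘ φ = id`
excludes a zero derivative. -/
theorem deriv_ne_zero (h : IsConformalMap φ U V) (hU : IsOpen U) {y : ℂ} (hy : y ∈ U) :
    deriv φ y ≠ 0 := by
  set ψ := Function.invFunOn φ U
  have hψφ : ∀ w ∈ U, ψ (φ w) = w := fun w hw => h.2.injOn.leftInvOn_invFunOn hw
  have hcont : ContinuousAt ψ (φ y) := by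
    rw [ContinuousAt, hψφ y hy]
    exact h.tendsto_invFunOn hU hy
  have hne : ∀ᶠ w in 𝓝[≠] y, deriv φ w ≠ 0 := by
    rcases (h.analyticAt hU hy).deriv.eventually_eq_zero_or_eventually_ne_zero with h0 | h0
    · exfalso
      obtain ⟨r, hr, hball⟩ := Metric.eventually_nhds_iff_ball.1
        (h0.and (hU.mem_nhds hy))
      apply h.not_eventually_const hU hy
      filter_upwards [Metric.ball_mem_nhds y hr] with w hw
      refine (convex_ball y r).is_const_of_fderivWithin_eq_zero (𝕜 := ℂ) (f := φ) ?_ ?_ hw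
        (Metric.mem_ball_self hr)
      · exact h.1.mono fun x hx => (hball x hx).2
      · intro x hx
        rw [fderivWithin_of_isOpen Metric.isOpen_ball hx, ← toSpanSingleton_deriv, (hball x hx).1]
        simp
    · exact h0
  have hdiff : ∀ᶠ w in 𝓝[≠] (φ y), DifferentiableAt ℂ ψ w := by
    have h1 : ∀ᶠ w in 𝓝 y, w ∈ U ∧ (w ≠ y → deriv φ w ≠ 0) :=
      (hU.eventually_mem hy).and (eventually_nhdsWithin_iff.1 hne)
    have h2 : ∀ᶠ w in 𝓝 y, φ w ≠ φ y → DifferentiableAt ℂ ψ (φ w) := by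
      filter_upwards [h1] with w hw hwy
      have hd := hw.2 fun e => hwy (by rw [e])
      have hder := (h.analyticAt hU hw.1).differentiableAt.hasDerivAt
      refine (HasDerivAt.of_local_left_inverse (f := φ) (g := ψ) (a := φ w) (f' := deriv φ w)
        ?_ ?_ hd ?_).differentiableAt
      · rw [ContinuousAt, hψφ w hw.1]
        exact h.tendsto_invFunOn hU hw.1
      · rwa [hψφ w hw.1]
      · have : ∀ᶠ v in map φ (𝓝 w), φ (ψ v) = v := by
          rw [eventually_map]
          filter_upwards [hU.mem_nhds hw.1] with x hx
          rw [hψφ x hx]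
        exact h.nhds_le_map hU hw.1 this
    have h3 : ∀ᶠ v in map φ (𝓝 y), v ≠ φ y → DifferentiableAt ℂ ψ v := h2
    exact eventually_nhdsWithin_iff.2 (h.nhds_le_map hU hy h3)
  have hψ : AnalyticAt ℂ ψ (φ y) :=
    Complex.analyticAt_of_differentiable_on_punctured_nhds_of_continuousAt hdiff hcont
  have hcomp : HasDerivAt (ψ ∘ φ) (deriv ψ (φ y) * deriv φ y) y :=
    hψ.differentiableAt.hasDerivAt.comp y (h.analyticAt hU hy).differentiableAt.hasDerivAt
  have hid : HasDerivAt (ψ ∘ φ) 1 y := by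
    refine (hasDerivAt_id y).congr_of_eventuallyEq ?_
    filter_upwards [hU.mem_nhds hy] with w hw
    exact hψφ w hw
  intro h0
  have := hcomp.unique hid
  rw [h0, mul_zero] at this
  exact zero_ne_one this

end IsConformalMap

/-! ### Maximum principle and uniqueness of the Green's function. -/

/-- **Maximum principle**: a harmonic function whose superlevel sets at positive levels are
relatively compact in its open domain is nonpositive. -/
theorem nonpos_of_harmonicOnNhd {U : Set ℂ} (hU : IsOpen U) {u : ℂ → ℝ}
    (hu : InnerProductSpace.HarmonicOnNhd u U)
    (h : ∀ δ > 0, ∃ K, IsCompact K ∧ K ⊆ U ∧ ∀ y ∈ U, δ ≤ u y → y ∈ K) :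
    ∀ y ∈ U, u y ≤ 0 := by
  intro y₀ hy₀
  by_contra! hpos
  obtain ⟨K, hK, hKU, hmem⟩ := h _ hpos
  have hcK : ContinuousOn u K := hu.continuousOn.mono hKU
  obtain ⟨p, hpK, hp⟩ := hK.exists_isMaxOn ⟨y₀, hmem y₀ hy₀ le_rfl⟩ hcK
  have hp0 : u y₀ ≤ u p := hp (hmem y₀ hy₀ le_rfl)
  have hmax : ∀ y ∈ U, u y ≤ u p := by
    intro y hy
    by_cases hyK : y ∈ K
    · exact hp hyK
    · by_contra! hlt
      exact hyK (hmem y hy (hp0.trans hlt.le))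
  -- The set where the maximum is attained is compact, open in `ℂ` and nonempty. This is impossible
  -- because `ℂ` is connected and not compact, so `U` itself need not be connected.
  have hA : IsCompact (K ∩ u ⁻¹' {u p}) :=
    hK.of_isClosed_subset (hcK.preimage_isClosed_of_isClosed hK.isClosed isClosed_singleton)
      Set.inter_subset_left
  have hopen : IsOpen (K ∩ u ⁻¹' {u p}) := by
    rw [isOpen_iff_mem_nhds]
    rintro y ⟨hyK, hy⟩
    obtain ⟨r, hr, hrU⟩ := Metric.isOpen_iff.1 hU y (hKU hyK)
    -- Locally `u = Re F`, so `|exp F| = exp u` and the maximum modulus principle applies.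
    obtain ⟨F, hF, hFu⟩ :=
      InnerProductSpace.HarmonicOnNhd.exists_analyticOnNhd_ball_re_eq (hu.mono hrU)
    have hball : ∀ᶠ w in 𝓝 y, w ∈ Metric.ball y r := Metric.ball_mem_nhds y hr
    have hnorm : ∀ w ∈ Metric.ball y r, ‖Complex.exp (F w)‖ = Real.exp (u w) := by
      intro w hw
      rw [Complex.norm_exp, ← hFu hw]
    have hyb := Metric.mem_ball_self (x := y) hr
    have hd : ∀ᶠ w in 𝓝 y, DifferentiableAt ℂ (fun w => Complex.exp (F w)) w := by
      filter_upwards [hball] with w hw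
      exact (hF w hw).differentiableAt.cexp
    have hloc : IsLocalMax (norm ∘ fun w => Complex.exp (F w)) y := by
      filter_upwards [hball] with w hw
      simp only [Function.comp_apply]
      rw [hnorm w hw, hnorm y hyb]
      exact Real.exp_le_exp.2 ((hmax w (hrU hw)).trans_eq hy.symm)
    filter_upwards [Complex.eventually_eq_of_isLocalMax_norm hd hloc, hball] with w hw hwb
    have h1 : u w = u y := by
      have := congrArg norm hw
      rw [hnorm w hwb, hnorm y hyb] at this
      exact Real.exp_injective this
    have h2 : u w = u p := h1.trans hy
    exact ⟨hmem w (hrU hwb) (hp0.trans h2.ge), h2⟩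
  have hne : (K ∩ u ⁻¹' {u p}).Nonempty := ⟨p, hpK, rfl⟩
  exact hA.ne_univ (IsClopen.eq_univ ⟨hA.isClosed, hopen⟩ hne)

/-- A function vanishing at the boundary of `D` is small off a compact subset of `D`. -/
theorem exists_isCompact_abs_lt {D : Opens ℂ} {F : ℂ → ℝ}
    (hF : Tendsto (fun y : D => F y) (cocompact D) (𝓝 0)) {η : ℝ} (hη : 0 < η) :
    ∃ K, IsCompact K ∧ K ⊆ (D : Set ℂ) ∧ ∀ y ∈ D, y ∉ K → |F y| < η := by
  have h := (Metric.tendsto_nhds.1 hF) η hη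
  obtain ⟨K, hK, hKs⟩ := mem_cocompact.1 h
  refine ⟨Subtype.val '' K, hK.image continuous_subtype_val, ?_, ?_⟩
  · rintro _ ⟨y, -, rfl⟩
    exact y.2
  · intro y hy hyK
    have : (⟨y, hy⟩ : D) ∈ Kᶜ := fun hm => hyK ⟨_, hm, rfl⟩
    simpa [Real.dist_eq] using hKs this

theorem tendsto_log_inv_norm_sub (z : ℂ) :
    Tendsto (fun y => Real.log (1 / ‖z - y‖)) (𝓝[≠] z) atTop := by
  have h1 : Tendsto (fun y => ‖z - y‖) (𝓝[≠] z) (𝓝[>] 0) := by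
    refine tendsto_nhdsWithin_iff.2 ⟨?_, ?_⟩
    · have : Tendsto (fun y => ‖z - y‖) (𝓝 z) (𝓝 ‖z - z‖) := by
        exact (Continuous.tendsto (by fun_prop) z)
      rw [sub_self, norm_zero] at this
      exact this.mono_left nhdsWithin_le_nhds
    · filter_upwards [eventually_mem_nhdsWithin] with y hy
      exact norm_pos_iff.2 (sub_ne_zero.2 (Ne.symm hy))
  have h2 := tendsto_neg_atBot_atTop.comp (Real.tendsto_log_nhdsGT_zero.comp h1)
  refine h2.congr fun y => ?_
  simp [Real.log_inv]

namespace IsGreenFunction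

variable {D : Opens ℂ} {z : ℂ} {G G' g : ℂ → ℝ}

/-- Asymptotic equivalence at the pole only gives `G - G' = o(log)`, not boundedness. Subtracting `δ
• g` absorbs this error near `z`, and `0 ≤ g` keeps the boundary behaviour. The maximum principle
applies, and then `δ → 0`. -/
theorem le_of_nonneg (hG : IsGreenFunction D z G) (hG' : IsGreenFunction D z G')
    (hg : IsGreenFunction D z g) (hg0 : ∀ y ∈ (D : Set ℂ) \ {z}, 0 ≤ g y) :
    ∀ y ∈ (D : Set ℂ) \ {z}, G y ≤ G' y := by
  have hU : IsOpen ((D : Set ℂ) \ {z}) := D.isOpen.sdiff isClosed_singleton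
  have key : ∀ δ : ℝ, 0 < δ → ∀ y ∈ (D : Set ℂ) \ {z}, (G - G' - δ • g) y ≤ 0 := by
    intro δ hδ
    refine nonpos_of_harmonicOnNhd hU
      ((hG.harmonic.sub hG'.harmonic).sub hg.harmonic.const_smul) ?_
    intro η hη
    have hv : Tendsto (fun y : D => (G - G') y) (cocompact D) (𝓝 0) := by
      simpa using hG.vanishes.sub hG'.vanishes
    obtain ⟨K, hK, hKD, hKη⟩ := exists_isCompact_abs_lt hv hη
    have ho : (fun y => G y - G' y) =o[𝓝[≠] z] fun y => Real.log (1 / ‖z - y‖) := by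
      have := hG.singularity.isLittleO.sub hG'.singularity.isLittleO
      refine this.congr_left fun y => ?_
      simp
    have hev : ∀ᶠ y in 𝓝[≠] z, (G - G' - δ • g) y ≤ 0 := by
      filter_upwards [ho.def (half_pos hδ), hg.singularity.isLittleO.def (half_pos one_pos),
        (tendsto_log_inv_norm_sub z).eventually_gt_atTop 0] with y h1 h2 h3
      rw [Real.norm_eq_abs, Real.norm_eq_abs, abs_of_pos h3] at h1 h2
      simp only [Pi.sub_apply, Pi.smul_apply, smul_eq_mul] at h2 ⊢
      have h1' := (abs_le.1 h1).2
      have h2' := (abs_le.1 h2).1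
      nlinarith
    obtain ⟨r, hr, hball⟩ := Metric.eventually_nhds_iff_ball.1 (eventually_nhdsWithin_iff.1 hev)
    refine ⟨K \ Metric.ball z r, hK.diff Metric.isOpen_ball, ?_, ?_⟩
    · rintro y ⟨hyK, hyb⟩
      refine ⟨hKD hyK, ?_⟩
      rintro rfl
      exact hyb (Metric.mem_ball_self hr)
    · intro y hy hyη
      refine ⟨?_, ?_⟩
      · by_contra hyK
        have h1 := (abs_lt.1 (hKη y hy.1 hyK)).2
        have h2 := hg0 y hy
        simp only [Pi.sub_apply, Pi.smul_apply, smul_eq_mul] at h1 hyη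
        nlinarith [mul_nonneg hδ.le h2]
      · intro hyb
        linarith [hball y hyb hy.2]
  intro y hy
  have h1 : Tendsto (fun δ : ℝ => (G - G' - δ • g) y) (𝓝[>] 0) (𝓝 (G y - G' y)) := by
    have : Continuous fun δ : ℝ => (G - G' - δ • g) y := by
      simp only [Pi.sub_apply, Pi.smul_apply, smul_eq_mul]
      fun_prop
    have := (this.tendsto 0).mono_left (nhdsWithin_le_nhds (s := Set.Ioi 0))
    simpa using this
  have := le_of_tendsto h1 (by
    filter_upwards [self_mem_nhdsWithin] with δ hδ using key δ hδ y hy)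
  linarith

theorem eqOn_of_nonneg (hG : IsGreenFunction D z G) (hg : IsGreenFunction D z g)
    (hg0 : ∀ y ∈ (D : Set ℂ) \ {z}, 0 ≤ g y) : Set.EqOn G g ((D : Set ℂ) \ {z}) :=
  fun y hy => le_antisymm (hG.le_of_nonneg hg hg hg0 y hy) (hg.le_of_nonneg hG hg hg0 y hy)

end IsGreenFunction

/-! ### The Green's function and its correction in terms of the conformal map. -/

section ConformalToDisc

variable {D : Opens ℂ} {z : ℂ} {φ : ℂ → ℂ}

theorem dslope_ne_zero_of_isConformalMap (hφ : IsConformalMap φ D (Metric.ball 0 1)) (hz : z ∈ D)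
    (hφz : φ z = 0) {y : ℂ} (hy : y ∈ D) : dslope φ z y ≠ 0 := by
  by_cases h : y = z
  · subst h
    rw [dslope_same]
    exact hφ.deriv_ne_zero D.isOpen hy
  · rw [dslope_of_ne _ h, slope_def_field, hφz, sub_zero]
    refine div_ne_zero (fun h0 => h ?_) (sub_ne_zero.2 h)
    exact hφ.2.injOn hy hz (h0.trans hφz.symm)

theorem analyticAt_dslope (hφ : IsConformalMap φ D (Metric.ball 0 1)) (hz : z ∈ D)
    {y : ℂ} (hy : y ∈ D) : AnalyticAt ℂ (dslope φ z) y :=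
  ((Complex.differentiableOn_dslope (D.isOpen.mem_nhds hz)).2 hφ.1).analyticAt
    (D.isOpen.mem_nhds hy)

/-- The factorization `φ y = (y - z) * dslope φ z y` splits off the logarithmic pole. The second
factor has no zero in `D`, so its log-modulus is harmonic across `z` as well. -/
theorem log_norm_eq_add_log_dslope (hφ : IsConformalMap φ D (Metric.ball 0 1)) (hz : z ∈ D)
    (hφz : φ z = 0) {y : ℂ} (hy : y ∈ D) (hyz : y ≠ z) :
    Real.log ‖φ y‖ = Real.log ‖y - z‖ + Real.log ‖dslope φ z y‖ := by
  have h1 : φ y = (y - z) * dslope φ z y := by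
    have := sub_smul_dslope φ z y
    rw [hφz, sub_zero] at this
    exact this.symm
  rw [h1, norm_mul, Real.log_mul (norm_ne_zero_iff.2 (sub_ne_zero.2 hyz))
    (norm_ne_zero_iff.2 (dslope_ne_zero_of_isConformalMap hφ hz hφz hy))]

theorem harmonicOnNhd_log_dslope (hφ : IsConformalMap φ D (Metric.ball 0 1)) (hz : z ∈ D)
    (hφz : φ z = 0) :
    InnerProductSpace.HarmonicOnNhd (fun y => -Real.log ‖dslope φ z y‖) D := fun _ hy =>
  ((analyticAt_dslope hφ hz hy).harmonicAt_log_norm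
    (dslope_ne_zero_of_isConformalMap hφ hz hφz hy)).neg

theorem neg_log_norm_nonneg (hφ : IsConformalMap φ D (Metric.ball 0 1)) {y : ℂ} (hy : y ∈ D) :
    0 ≤ -Real.log ‖φ y‖ := by
  have := hφ.2.mapsTo hy
  rw [mem_ball_zero_iff] at this
  exact neg_nonneg.2 (Real.log_nonpos (norm_nonneg _) this.le)

theorem isGreenFunction_neg_log (hφ : IsConformalMap φ D (Metric.ball 0 1)) (hz : z ∈ D)
    (hφz : φ z = 0) : IsGreenFunction D z fun y => -Real.log ‖φ y‖ where
  harmonic y hy := by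
    refine ((hφ.analyticAt D.isOpen hy.1).harmonicAt_log_norm fun h0 => hy.2 ?_).neg
    exact hφ.2.injOn hy.1 hz (h0.trans hφz.symm)
  vanishes := by
    have h1 : Tendsto (fun y : D => ‖φ y‖) (cocompact D) (𝓝 1) := by
      rw [tendsto_order]
      refine ⟨fun r hr => ?_, fun r hr => ?_⟩
      -- For `r < 1`, properness makes `|φ| > r` hold off a compact set.
      · have hc := hφ.isCompact_preimage D.isOpen (isCompact_closedBall (0 : ℂ) r)
          (Metric.closedBall_subset_ball hr)
        have hc' : IsCompact ((fun y : D => φ y) ⁻¹' Metric.closedBall 0 r) := by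
          rw [Subtype.isCompact_iff]
          convert hc using 1
          ext y
          simp [and_comm]
        filter_upwards [hc'.compl_mem_cocompact] with y hy
        simpa using hy
      · refine Eventually.of_forall fun y => lt_trans ?_ hr
        simpa using hφ.2.mapsTo y.2
    have := ((Real.continuousAt_log one_ne_zero).tendsto.comp h1).neg
    simpa using this
  singularity := by
    have h1 : (fun y => -Real.log ‖dslope φ z y‖) =O[𝓝[≠] z] fun _ => (1 : ℝ) :=
      (((harmonicOnNhd_log_dslope hφ hz hφz) z hz).1.continuousAt.tendsto.mono_left
        nhdsWithin_le_nhds).isBigO_one ℝ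
    have h2 : (fun _ => (1 : ℝ)) =o[𝓝[≠] z] fun y => Real.log (1 / ‖z - y‖) :=
      Asymptotics.isLittleO_const_left.2 (Or.inr
        (tendsto_abs_atTop_atTop.comp (tendsto_log_inv_norm_sub z)))
    refine (h1.trans_isLittleO h2).congr' ?_ .rfl
    filter_upwards [eventually_mem_nhdsWithin, nhdsWithin_le_nhds (D.isOpen.mem_nhds hz)]
      with y hyz hy
    simp only [Pi.sub_apply]
    rw [log_norm_eq_add_log_dslope hφ hz hφz hy hyz, norm_sub_rev z y, one_div, Real.log_inv]
    ring

theorem greenFunction_eqOn (hφ : IsConformalMap φ D (Metric.ball 0 1)) (hz : z ∈ D)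
    (hφz : φ z = 0) :
    Set.EqOn (greenFunction D z) (fun y => -Real.log ‖φ y‖) ((D : Set ℂ) \ {z}) := by
  have hg := isGreenFunction_neg_log hφ hz hφz
  have hex : ∃ G, IsGreenFunction D z G := ⟨_, hg⟩
  rw [greenFunction, dif_pos hex]
  exact hex.choose_spec.eqOn_of_nonneg hg fun y hy => neg_log_norm_nonneg hφ hy.1

theorem greenCorrection_eqOn (hφ : IsConformalMap φ D (Metric.ball 0 1)) (hz : z ∈ D)
    (hφz : φ z = 0) :
    Set.EqOn (greenCorrection D z) (fun y => -Real.log ‖dslope φ z y‖) D := by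
  have h1 : ∀ y ∈ D, y ≠ z → greenFunction D z y - Real.log (1 / ‖z - y‖) =
      -Real.log ‖dslope φ z y‖ := by
    intro y hy hyz
    rw [greenFunction_eqOn hφ hz hφz ⟨hy, hyz⟩]
    beta_reduce
    rw [log_norm_eq_add_log_dslope hφ hz hφz hy hyz,
      norm_sub_rev z y, one_div, Real.log_inv]
    ring
  intro y hy
  by_cases hyz : y = z
  · subst hyz
    rw [greenCorrection, Function.update_self]
    -- At the pole the correction is defined as a limit, which exists because `-log |dslope φ z|` is
    -- continuous there.
    refine Tendsto.limUnder_eq ?_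
    have h2 := (((harmonicOnNhd_log_dslope hφ hy hφz) y hy).1.continuousAt.tendsto.mono_left
      (nhdsWithin_le_nhds (s := {y}ᶜ)))
    refine h2.congr' ?_
    filter_upwards [eventually_mem_nhdsWithin, nhdsWithin_le_nhds (D.isOpen.mem_nhds hy)]
      with w hwy hw
    exact (h1 w hw hwy).symm
  · rw [greenCorrection, Function.update_of_ne hyz]
    exact h1 y hy hyz

end ConformalToDisc

/-! ### Gradient, Laplacian and integration by parts in the plane. -/

theorem inner_gradient_apply (u : ℂ → ℝ) (y v : ℂ) :
    inner ℝ (gradient u y) v = fderiv ℝ u y v := by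
  rw [gradient, InnerProductSpace.toDual_symm_apply]

theorem inner_gradient_gradient (u v : ℂ → ℝ) (y : ℂ) :
    inner ℝ (gradient u y) (gradient v y) =
      fderiv ℝ u y 1 * fderiv ℝ v y 1 + fderiv ℝ u y Complex.I * fderiv ℝ v y Complex.I := by
  simp only [← inner_gradient_apply, Complex.inner]
  simp
  ring

theorem laplacian_eq_fderiv_add {f : ℂ → ℝ} {y : ℂ} (hf : ContDiffAt ℝ 2 f y) :
    laplacian f y = fderiv ℝ (fun w => fderiv ℝ f w 1) y 1 +
      fderiv ℝ (fun w => fderiv ℝ f w Complex.I) y Complex.I := by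
  have hd : DifferentiableAt ℝ (fderiv ℝ f) y :=
    (hf.fderiv_right (m := 1) (by norm_num)).differentiableAt (by simp)
  rw [InnerProductSpace.laplacian_eq_iteratedFDeriv_complexPlane]
  simp only [iteratedFDeriv_two_apply]
  rw [fderiv_clm_apply hd (differentiableAt_const _),
    fderiv_clm_apply hd (differentiableAt_const _)]
  simp

/-- Green's first identity without boundary term. -/
theorem integral_inner_gradient {u v : ℂ → ℝ} (hu : ContDiff ℝ 1 u) (hv : ContDiff ℝ 2 v)
    (hvs : HasCompactSupport v) :
    ∫ y, inner ℝ (gradient u y) (gradient v y) = -∫ y, u y * laplacian v y := by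
  have hcu : ∀ e : ℂ, Continuous fun y => fderiv ℝ u y e := fun e =>
    (hu.continuous_fderiv (by simp)).clm_apply continuous_const
  have hv1 : ∀ e : ℂ, ContDiff ℝ 1 fun y => fderiv ℝ v y e := fun e =>
    (hv.fderiv_right (m := 1) (by norm_num)).clm_apply contDiff_const
  have hvs1 : ∀ e : ℂ, HasCompactSupport fun y => fderiv ℝ v y e := fun e =>
    hvs.fderiv_apply (𝕜 := ℝ) e
  have hcv : ∀ e : ℂ, Continuous fun y => fderiv ℝ (fun w => fderiv ℝ v w e) y e := fun e =>
    ((hv1 e).continuous_fderiv (by simp)).clm_apply continuous_const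
  have hI1 : ∀ e : ℂ, Integrable fun y => fderiv ℝ u y e * fderiv ℝ v y e := fun e =>
    ((hcu e).mul (hv1 e).continuous).integrable_of_hasCompactSupport (hvs1 e).mul_left
  have hI2 : ∀ e : ℂ, Integrable fun y => u y * fderiv ℝ (fun w => fderiv ℝ v w e) y e := fun e =>
    (hu.continuous.mul (hcv e)).integrable_of_hasCompactSupport
      ((hvs1 e).fderiv_apply (𝕜 := ℝ) e).mul_left
  have key : ∀ e : ℂ, ∫ y, u y * fderiv ℝ (fun w => fderiv ℝ v w e) y e =
      -∫ y, fderiv ℝ u y e * fderiv ℝ v y e := fun e =>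
    integral_mul_fderiv_eq_neg_fderiv_mul_of_integrable (hI1 e) (hI2 e)
      ((hu.continuous.mul (hv1 e).continuous).integrable_of_hasCompactSupport (hvs1 e).mul_left)
      (fun y _ => (hu.differentiable (by simp)) y)
      (fun y _ => ((hv1 e).differentiable (by simp)) y)
  simp only [inner_gradient_gradient, fun y => laplacian_eq_fderiv_add (hv.contDiffAt (x := y)),
    mul_add]
  rw [integral_add (hI1 _) (hI1 _), integral_add (hI2 _) (hI2 _), key, key]
  ring

theorem integral_laplacian_eq_zero {v : ℂ → ℝ} (hv : ContDiff ℝ 2 v) (hvs : HasCompactSupport v) :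
    ∫ y, laplacian v y = 0 := by
  have := integral_inner_gradient (u := fun _ => (1 : ℝ)) contDiff_const hv hvs
  have h0 : ∀ y, gradient (fun _ : ℂ => (1 : ℝ)) y = 0 := fun y => by simp [gradient]
  simpa [h0] using this

theorem continuous_laplacian {v : ℂ → ℝ} (hv : ContDiff ℝ 2 v) : Continuous (laplacian v) := by
  have hcv : ∀ e : ℂ, Continuous fun y => fderiv ℝ (fun w => fderiv ℝ v w e) y e := fun e =>
    (((hv.fderiv_right (m := 1) (by norm_num)).clm_apply contDiff_const).continuous_fderiv
      (by simp)).clm_apply continuous_const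
  rw [show laplacian v = _ from funext fun y => laplacian_eq_fderiv_add (hv.contDiffAt (x := y))]
  exact (hcv 1).add (hcv Complex.I)

theorem tsupport_laplacian_subset (v : ℂ → ℝ) : tsupport (laplacian v) ⊆ tsupport v := by
  refine closure_minimal ?_ (isClosed_tsupport v)
  intro y hy
  by_contra hyv
  apply hy
  have h : v =ᶠ[𝓝 y] fun _ => 0 := notMem_tsupport_iff_eventuallyEq.1 hyv
  rw [(InnerProductSpace.laplacian_congr_nhds h).eq_of_nhds]
  simp

/-- The chain rule for the Laplacian. -/
theorem laplacian_comp {S : ℝ → ℝ} (hS : ContDiff ℝ 2 S) {f : ℂ → ℝ} {y : ℂ}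
    (hf : ContDiffAt ℝ 2 f y) :
    laplacian (fun w => S (f w)) y =
      deriv S (f y) * laplacian f y + deriv (deriv S) (f y) * ‖gradient f y‖ ^ 2 := by
  have hS1 : ContDiff ℝ 1 (deriv S) := by
    have : ContDiff ℝ (1 + 1) S := hS
    exact (contDiff_succ_iff_deriv.1 this).2.2
  have key : ∀ e : ℂ, fderiv ℝ (fun w => fderiv ℝ (fun w => S (f w)) w e) y e =
      deriv S (f y) * fderiv ℝ (fun w => fderiv ℝ f w e) y e +
        deriv (deriv S) (f y) * (fderiv ℝ f y e * fderiv ℝ f y e) := by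
    intro e
    have h1 : (fun w => fderiv ℝ (fun w => S (f w)) w e) =ᶠ[𝓝 y]
        fun w => deriv S (f w) * fderiv ℝ f w e := by
      filter_upwards [hf.eventually (by simp)] with w hw
      have hSd := (hS.differentiable (by simp) (f w)).hasDerivAt
      have := hSd.comp_hasFDerivAt w (hw.differentiableAt (by simp)).hasFDerivAt
      rw [show (fun w => S (f w)) = S ∘ f from rfl, this.fderiv]
      simp
    rw [h1.fderiv_eq]
    have h2 : HasFDerivAt (fun w => deriv S (f w)) (deriv (deriv S) (f y) • fderiv ℝ f y) y :=
      ((hS1.differentiable (by simp) (f y)).hasDerivAt).comp_hasFDerivAt y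
        (hf.differentiableAt (by simp)).hasFDerivAt
    have h3 : DifferentiableAt ℝ (fun w => fderiv ℝ f w e) y :=
      ((hf.fderiv_right (m := 1) (by norm_num)).differentiableAt (by simp)).clm_apply
        (differentiableAt_const _)
    have h4 : fderiv ℝ (fun w => deriv S (f w) * fderiv ℝ f w e) y = _ :=
      (h2.mul h3.hasFDerivAt).fderiv
    rw [h4]
    simp
    ring
  have hc : ContDiffAt ℝ 2 (fun w => S (f w)) y := hS.contDiffAt.comp y hf
  rw [laplacian_eq_fderiv_add hc, laplacian_eq_fderiv_add hf, key, key,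
    ← real_inner_self_eq_norm_sq, inner_gradient_gradient]
  ring

theorem norm_gradient_log_norm_sub {y z : ℂ} (hyz : y ≠ z) :
    ‖gradient (fun w => Real.log ‖w - z‖) y‖ = ‖y - z‖⁻¹ := by
  have hpos : 0 < ‖y - z‖ := norm_pos_iff.2 (sub_ne_zero.2 hyz)
  have h1 : HasFDerivAt (fun w : ℂ => ‖w - z‖ ^ 2) (2 • innerSL ℝ (y - z)) y := by
    have := (hasStrictFDerivAt_norm_sq (y - z)).hasFDerivAt.comp y
      ((hasFDerivAt_id (𝕜 := ℝ) y).sub_const z)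
    simpa [Function.comp_def] using this
  have h2 := (h1.log (by positivity)).const_mul (1 / 2 : ℝ)
  have h3 : (fun w => Real.log ‖w - z‖) = fun w => 1 / 2 * Real.log (‖w - z‖ ^ 2) := by
    funext w
    rw [Real.log_pow]
    push_cast
    ring
  have h4 : HasGradientAt (fun w => Real.log ‖w - z‖) ((‖y - z‖ ^ 2)⁻¹ • (y - z)) y := by
    rw [h3, hasGradientAt_iff_hasFDerivAt]
    refine h2.congr_fderiv ?_
    ext v
    rw [InnerProductSpace.toDual_apply_apply, real_inner_smul_left]
    simp only [smul_apply, innerSL_apply_apply, smul_eq_mul, nsmul_eq_mul]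
    push_cast
    ring
  rw [h4.gradient, norm_smul, norm_inv, norm_pow, norm_norm]
  field_simp

theorem laplacian_log_norm_sub {y z : ℂ} (hyz : y ≠ z) :
    laplacian (fun w => Real.log ‖w - z‖) y = 0 := by
  have h : AnalyticAt ℂ (fun w => w - z) y := by fun_prop
  exact (h.harmonicAt_log_norm (sub_ne_zero.2 hyz)).2.eq_of_nhds

/-- A harmonic function integrated against a radial weight. -/
theorem integral_radial_mul_harmonic {z : ℂ} {ε r₁ r₂ : ℝ} {w : ℝ → ℝ} {H : ℂ → ℝ}
    (hr₁ : 0 < r₁) (hr : r₁ ≤ r₂) (hr₂ : r₂ < ε) (hw : ContinuousOn w (Set.Icc r₁ r₂))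
    (hw0 : ∀ r, 0 < r → r ∉ Set.Icc r₁ r₂ → w r = 0)
    (hH : InnerProductSpace.HarmonicOnNhd H (Metric.ball z ε)) :
    ∫ y, w ‖y - z‖ * H y = 2 * Real.pi * H z * ∫ r in r₁..r₂, r * w r := by
  have hmem : ∀ r ∈ Set.Icc r₁ r₂, ∀ θ, circleMap z r θ ∈ Metric.ball z ε := by
    intro r hr' θ
    rw [Metric.mem_ball, Metric.mem_sphere.1 (circleMap_mem_sphere z (hr₁.le.trans hr'.1) θ)]
    exact hr'.2.trans_lt hr₂
  have hcont : ContinuousOn (fun p : ℝ × ℝ => p.1 * (w p.1 * H (circleMap z p.1 p.2)))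
      (Set.Icc r₁ r₂ ×ˢ Set.Icc (-Real.pi) Real.pi) := by
    refine continuousOn_fst.mul (ContinuousOn.mul ?_ ?_)
    · exact hw.comp continuousOn_fst fun p hp => hp.1
    · refine hH.continuousOn.comp (Continuous.continuousOn ?_) fun p hp => hmem _ hp.1 _
      unfold circleMap
      fun_prop
  have hint : IntegrableOn (fun p : ℝ × ℝ => p.1 * (w p.1 * H (circleMap z p.1 p.2)))
      (Set.Icc r₁ r₂ ×ˢ Set.Ioo (-Real.pi) Real.pi) (volume.prod volume) :=
    (hcont.integrableOn_compact (isCompact_Icc.prod isCompact_Icc)).mono_set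
      (Set.prod_mono le_rfl Set.Ioo_subset_Icc_self)
  calc ∫ y, w ‖y - z‖ * H y
      = ∫ y, w ‖y‖ * H (z + y) := by
        rw [← integral_add_left_eq_self (fun y => w ‖y - z‖ * H y) z]
        simp
    _ = ∫ p in polarCoord.target, p.1 * (w p.1 * H (circleMap z p.1 p.2)) := by
        rw [← Complex.integral_comp_polarCoord_symm]
        refine setIntegral_congr_fun polarCoord.open_target.measurableSet fun p hp => ?_
        have hp1 : 0 < p.1 := hp.1
        simp only [smul_eq_mul, Complex.norm_polarCoord_symm, abs_of_pos hp1]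
        simp only [Complex.polarCoord_symm_apply, circleMap, Complex.exp_mul_I,
          Complex.ofReal_cos, Complex.ofReal_sin]
    _ = ∫ p in Set.Icc r₁ r₂ ×ˢ Set.Ioo (-Real.pi) Real.pi,
          p.1 * (w p.1 * H (circleMap z p.1 p.2)) := by
        refine setIntegral_eq_of_subset_of_forall_sdiff_eq_zero
          polarCoord.open_target.measurableSet ?_ ?_
        · exact fun p hp => ⟨hr₁.trans_le hp.1.1, hp.2⟩
        · rintro p ⟨hp, hp'⟩
          rw [hw0 p.1 hp.1 fun h => hp' ⟨h, hp.2⟩]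
          simp
    _ = ∫ r in Set.Icc r₁ r₂, ∫ θ in Set.Ioo (-Real.pi) Real.pi,
          r * (w r * H (circleMap z r θ)) := setIntegral_prod _ hint
    _ = ∫ r in Set.Icc r₁ r₂, 2 * Real.pi * H z * (r * w r) := by
        refine setIntegral_congr_fun measurableSet_Icc fun r hr' => ?_
        have hr0 : 0 < r := hr₁.trans_le hr'.1
        -- Mean value property on each circle; the radial weight is constant along it.
        have hmv : Real.circleAverage H z r = H z := by
          refine InnerProductSpace.HarmonicOnNhd.circleAverage_eq (hH.mono ?_)
          rw [abs_of_pos hr0]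
          exact Metric.closedBall_subset_ball (hr'.2.trans_lt hr₂)
        have hper : ∫ θ in (-Real.pi)..Real.pi, H (circleMap z r θ) =
            ∫ θ in (0 : ℝ)..(2 * Real.pi), H (circleMap z r θ) := by
          have hp : Function.Periodic (fun θ => H (circleMap z r θ)) (2 * Real.pi) := fun θ => by
            simp only [periodic_circleMap z r θ]
          have := hp.intervalIntegral_add_eq (-Real.pi) 0
          rw [zero_add] at this
          rw [← this]
          congr 1
          ring
        rw [Real.circleAverage_def, ← hper, smul_eq_mul] at hmv
        have hpi := Real.pi_pos
        simp only [integral_const_mul]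
        rw [← integral_Ioc_eq_integral_Ioo, ← intervalIntegral.integral_of_le (by linarith), ← hmv]
        field_simp
    _ = 2 * Real.pi * H z * ∫ r in r₁..r₂, r * w r := by
        rw [integral_const_mul, integral_Icc_eq_integral_Ioc, intervalIntegral.integral_of_le hr]

theorem two_le_infty : (2 : WithTop ℕ∞) ≤ ((⊤ : ℕ∞) : WithTop ℕ∞) :=
  WithTop.coe_le_coe.2 le_top

/-! ### A smooth convex approximation of the positive part -/

/-- A smooth convex function, vanishing for `s ≤ 0` and of slope one for `s ≥ a`. -/
def softRamp (a s : ℝ) : ℝ := ∫ t in (0 : ℝ)..s, Real.smoothTransition (t / a)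

namespace softRamp

variable {a : ℝ}

theorem continuous_slope (a : ℝ) : Continuous fun t => Real.smoothTransition (t / a) :=
  Real.smoothTransition.continuous.comp (by fun_prop)

theorem deriv_eq (a : ℝ) : deriv (softRamp a) = fun s => Real.smoothTransition (s / a) :=
  funext fun _ => (intervalIntegral.integral_hasDerivAt_right
    ((continuous_slope a).intervalIntegrable _ _)
    ((continuous_slope a).stronglyMeasurableAtFilter _ _) (continuous_slope a).continuousAt).deriv

theorem differentiable (a : ℝ) : Differentiable ℝ (softRamp a) := fun _ =>
  (intervalIntegral.integral_hasDerivAt_right ((continuous_slope a).intervalIntegrable _ _)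
    ((continuous_slope a).stronglyMeasurableAtFilter _ _) (continuous_slope a).continuousAt
    ).differentiableAt

theorem contDiff (a : ℝ) : ContDiff ℝ (⊤ : ℕ∞) (softRamp a) := by
  rw [contDiff_infty_iff_deriv, deriv_eq]
  exact ⟨differentiable a, Real.smoothTransition.contDiff.comp (by fun_prop)⟩

theorem sub_eq (a s t : ℝ) :
    softRamp a t - softRamp a s = ∫ x in s..t, Real.smoothTransition (x / a) :=
  intervalIntegral.integral_interval_sub_left ((continuous_slope a).intervalIntegrable _ _)
    ((continuous_slope a).intervalIntegrable _ _)

theorem monotone (a : ℝ) : Monotone (softRamp a) := by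
  intro s t hst
  rw [← sub_nonneg, sub_eq]
  exact intervalIntegral.integral_nonneg hst fun x _ => Real.smoothTransition.nonneg _

theorem sub_le_sub {s t : ℝ} (hst : s ≤ t) : softRamp a t - softRamp a s ≤ t - s := by
  rw [sub_eq]
  calc ∫ x in s..t, Real.smoothTransition (x / a) ≤ ∫ _ in s..t, (1 : ℝ) :=
        intervalIntegral.integral_mono_on hst ((continuous_slope a).intervalIntegrable _ _)
          (by simp) fun x _ => Real.smoothTransition.le_one _
    _ = t - s := by simp

theorem eq_zero (ha : 0 < a) {s : ℝ} (hs : s ≤ 0) : softRamp a s = 0 := by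
  rw [softRamp, intervalIntegral.integral_congr (g := fun _ => 0)]
  · simp
  · intro t ht
    rw [Set.uIcc_of_ge hs] at ht
    exact Real.smoothTransition.zero_of_nonpos (div_nonpos_of_nonpos_of_nonneg ht.2 ha.le)

theorem nonneg (ha : 0 < a) (s : ℝ) : 0 ≤ softRamp a s := by
  rcases le_total s 0 with hs | hs
  · rw [eq_zero ha hs]
  · rw [← eq_zero ha le_rfl]
    exact monotone a hs

theorem le_self (ha : 0 < a) {s : ℝ} (hs : 0 ≤ s) : softRamp a s ≤ s := by
  have := sub_le_sub (a := a) hs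
  rw [eq_zero ha le_rfl] at this
  linarith

theorem sub_eq_of_le (ha : 0 < a) {s t : ℝ} (hs : a ≤ s) (ht : a ≤ t) :
    softRamp a t - softRamp a s = t - s := by
  rw [sub_eq, intervalIntegral.integral_congr (g := fun _ => 1)]
  · simp
  · intro x hx
    exact Real.smoothTransition.one_of_one_le ((one_le_div ha).2 ((le_min hs ht).trans hx.1))

theorem sub_le_self (ha : 0 < a) (s : ℝ) : s - a ≤ softRamp a s := by
  rcases le_total s a with hs | hs
  · exact (sub_nonpos.2 hs).trans (nonneg ha s)
  · have := sub_eq_of_le ha le_rfl hs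
    linarith [nonneg ha a]

theorem deriv_nonneg (s : ℝ) : 0 ≤ deriv (softRamp a) s := by
  rw [deriv_eq]
  exact Real.smoothTransition.nonneg _

theorem deriv_le_one (s : ℝ) : deriv (softRamp a) s ≤ 1 := by
  rw [deriv_eq]
  exact Real.smoothTransition.le_one _

theorem deriv_eq_one (ha : 0 < a) {s : ℝ} (hs : a ≤ s) : deriv (softRamp a) s = 1 := by
  rw [deriv_eq]
  exact Real.smoothTransition.one_of_one_le ((one_le_div ha).2 hs)

theorem deriv_eq_zero (ha : 0 < a) {s : ℝ} (hs : s ≤ 0) : deriv (softRamp a) s = 0 := by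
  rw [deriv_eq]
  exact Real.smoothTransition.zero_of_nonpos (div_nonpos_of_nonpos_of_nonneg hs ha.le)

theorem contDiff_deriv (a : ℝ) : ContDiff ℝ (⊤ : ℕ∞) (deriv (softRamp a)) :=
  (contDiff_infty_iff_deriv.1 (contDiff a)).2

theorem hasDerivAt_deriv (a s : ℝ) :
    HasDerivAt (deriv (softRamp a)) (deriv (deriv (softRamp a)) s) s :=
  ((contDiff_deriv a).differentiable (by simp) s).hasDerivAt

theorem continuous_deriv_deriv (a : ℝ) : Continuous (deriv (deriv (softRamp a))) :=
  (contDiff_infty_iff_deriv.1 (contDiff_deriv a)).2.continuous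

theorem deriv_deriv_nonneg (ha : 0 < a) (s : ℝ) : 0 ≤ deriv (deriv (softRamp a)) s := by
  refine Monotone.deriv_nonneg ?_
  rw [deriv_eq]
  exact fun x y hxy => Real.smoothTransition.monotone (div_le_div_of_nonneg_right hxy ha.le)

theorem deriv_deriv_of_neg (ha : 0 < a) {s : ℝ} (hs : s < 0) :
    deriv (deriv (softRamp a)) s = 0 := by
  have : deriv (softRamp a) =ᶠ[𝓝 s] fun _ => 0 := by
    filter_upwards [Iio_mem_nhds hs] with t ht using deriv_eq_zero ha (le_of_lt ht)
  rw [this.deriv_eq, deriv_const]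

theorem deriv_deriv_of_lt (ha : 0 < a) {s : ℝ} (hs : a < s) :
    deriv (deriv (softRamp a)) s = 0 := by
  have : deriv (softRamp a) =ᶠ[𝓝 s] fun _ => 1 := by
    filter_upwards [Ioi_mem_nhds hs] with t ht using deriv_eq_one ha (le_of_lt ht)
  rw [this.deriv_eq, deriv_const]

end softRamp

/-! ### A smooth approximation of `log (max ε |y - z|)` -/

/-- A smooth radial function, equal to `log (|y - z| / ε)` up to a constant when
`|y - z| ≥ ε e⁻ᵇ`, and vanishing when `|y - z| ≤ ε e⁻²ᵇ`. -/
def logRamp (z : ℂ) (ε b : ℝ) (y : ℂ) : ℝ :=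
  if y = z then 0 else softRamp b (Real.log (‖y - z‖ / ε) + 2 * b)

/-- The Laplacian of `logRamp`. -/
def logRampDensity (z : ℂ) (ε b : ℝ) (y : ℂ) : ℝ :=
  deriv (deriv (softRamp b)) (Real.log (‖y - z‖ / ε) + 2 * b) / ‖y - z‖ ^ 2

section LogRamp

variable {z : ℂ} {ε b : ℝ}

theorem log_div_le_iff (hε : 0 < ε) {r t : ℝ} (hr : 0 < r) :
    Real.log (r / ε) ≤ t ↔ r ≤ ε * Real.exp t := by
  rw [Real.log_le_iff_le_exp (div_pos hr hε), div_le_iff₀' hε]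

theorem log_div_lt_iff (hε : 0 < ε) {r t : ℝ} (hr : 0 < r) :
    Real.log (r / ε) < t ↔ r < ε * Real.exp t := by
  rw [Real.log_lt_iff_lt_exp (div_pos hr hε), div_lt_iff₀' hε]

theorem logRamp_of_ne {y : ℂ} (hy : y ≠ z) :
    logRamp z ε b y = softRamp b (Real.log (‖y - z‖ / ε) + 2 * b) := if_neg hy

theorem logRamp_eventuallyEq_zero (hε : 0 < ε) (hb : 0 < b) : logRamp z ε b =ᶠ[𝓝 z] fun _ => 0 := by
  have hr : 0 < ε * Real.exp (-(2 * b)) := by positivity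
  filter_upwards [Metric.ball_mem_nhds z hr] with y hy
  by_cases hyz : y = z
  · exact if_pos hyz
  · rw [logRamp_of_ne hyz]
    rw [mem_ball_iff_norm] at hy
    have := (log_div_lt_iff hε (norm_pos_iff.2 (sub_ne_zero.2 hyz))).2 hy
    exact softRamp.eq_zero hb (by linarith)

theorem log_norm_sub_div_eq {y : ℂ} (hε : 0 < ε) (hy : y ≠ z) :
    Real.log (‖y - z‖ / ε) = Real.log ‖y - z‖ - Real.log ε :=
  Real.log_div (norm_ne_zero_iff.2 (sub_ne_zero.2 hy)) hε.ne'

theorem contDiffAt_log_norm_sub {y : ℂ} (hy : y ≠ z) :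
    ContDiffAt ℝ (⊤ : ℕ∞) (fun w => Real.log ‖w - z‖) y :=
  ((contDiff_id.sub contDiff_const).contDiffAt.norm ℝ (sub_ne_zero.2 hy)).log
    (norm_ne_zero_iff.2 (sub_ne_zero.2 hy))

theorem logRamp_eventuallyEq (hε : 0 < ε) {y : ℂ} (hy : y ≠ z) :
    logRamp z ε b =ᶠ[𝓝 y]
      fun w => softRamp b (Real.log ‖w - z‖ + (2 * b - Real.log ε)) := by
  filter_upwards [isOpen_ne.mem_nhds hy] with w hw
  rw [logRamp_of_ne hw, log_norm_sub_div_eq hε hw]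
  ring_nf

theorem contDiff_logRamp (hε : 0 < ε) (hb : 0 < b) : ContDiff ℝ (⊤ : ℕ∞) (logRamp z ε b) := by
  rw [contDiff_iff_contDiffAt]
  intro y
  by_cases hy : y = z
  · subst hy
    exact contDiffAt_const.congr_of_eventuallyEq (logRamp_eventuallyEq_zero hε hb)
  · refine ContDiffAt.congr_of_eventuallyEq ?_ (logRamp_eventuallyEq hε hy)
    exact (softRamp.contDiff b).contDiffAt.comp y
      ((contDiffAt_log_norm_sub hy).add contDiffAt_const)

/-- As `log |y - z|` is harmonic off `z`, the chain rule leaves only the second derivative of the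
ramp times `|∇ log|² = |y - z|⁻²`. Near `z` both sides vanish. -/
theorem laplacian_logRamp (hε : 0 < ε) (hb : 0 < b) :
    laplacian (logRamp z ε b) = logRampDensity z ε b := by
  funext y
  by_cases hy : y = z
  · subst hy
    rw [(InnerProductSpace.laplacian_congr_nhds (logRamp_eventuallyEq_zero hε hb)).eq_of_nhds]
    simp [logRampDensity]
  · have hc := (contDiffAt_log_norm_sub hy).of_le (m := 2) two_le_infty
    have hc' : ContDiffAt ℝ 2 (fun w => Real.log ‖w - z‖ + (2 * b - Real.log ε)) y :=
      hc.add contDiffAt_const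
    have hlap : laplacian (fun w => Real.log ‖w - z‖ + (2 * b - Real.log ε)) y = 0 := by
      have := hc.laplacian_add (contDiffAt_const (c := 2 * b - Real.log ε))
      rw [laplacian_log_norm_sub hy] at this
      refine Eq.trans this ?_
      simp
    have hgrad : gradient (fun w => Real.log ‖w - z‖ + (2 * b - Real.log ε)) y =
        gradient (fun w => Real.log ‖w - z‖) y := by
      simp only [gradient, fderiv_add_const]
    rw [(InnerProductSpace.laplacian_congr_nhds (logRamp_eventuallyEq hε hy)).eq_of_nhds,
      laplacian_comp ((softRamp.contDiff b).of_le two_le_infty) hc', hlap, hgrad,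
      norm_gradient_log_norm_sub hy, logRampDensity, log_norm_sub_div_eq hε hy]
    rw [mul_zero, zero_add, inv_pow, ← div_eq_mul_inv]
    ring_nf

theorem continuous_logRampDensity (hε : 0 < ε) (hb : 0 < b) :
    Continuous (logRampDensity z ε b) := by
  rw [← laplacian_logRamp hε hb]
  exact continuous_laplacian ((contDiff_logRamp hε hb).of_le two_le_infty)

theorem logRampDensity_nonneg (hb : 0 < b) (y : ℂ) : 0 ≤ logRampDensity z ε b y :=
  div_nonneg (softRamp.deriv_deriv_nonneg hb _) (by positivity)

theorem norm_sub_mem_Icc_of_logRampDensity_ne_zero (hε : 0 < ε) (hb : 0 < b) {y : ℂ}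
    (hy : logRampDensity z ε b y ≠ 0) :
    ‖y - z‖ ∈ Set.Icc (ε * Real.exp (-(2 * b))) (ε * Real.exp (-b)) := by
  have h0 : 0 < ‖y - z‖ := by
    refine (norm_nonneg _).lt_of_ne' fun h => hy ?_
    rw [logRampDensity, h]
    simp
  rw [logRampDensity] at hy
  refine ⟨?_, ?_⟩
  · by_contra! h
    rw [← log_div_lt_iff hε h0] at h
    exact hy (by rw [softRamp.deriv_deriv_of_neg hb (by linarith), zero_div])
  · by_contra! h
    have h' := not_le.1 (mt (log_div_le_iff hε h0).1 (not_le.2 h))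
    exact hy (by rw [softRamp.deriv_deriv_of_lt hb (by linarith), zero_div])

theorem exp_neg_mul_lt (hε : 0 < ε) (hb : 0 < b) : ε * Real.exp (-b) < ε := by
  have : Real.exp (-b) < 1 := Real.exp_lt_one_iff.2 (by linarith)
  nlinarith

theorem tsupport_logRampDensity_subset (hε : 0 < ε) (hb : 0 < b) :
    tsupport (logRampDensity z ε b) ⊆ Metric.closedBall z (ε * Real.exp (-b)) :=
  closure_minimal (fun _ hy => mem_closedBall_iff_norm.2
    (norm_sub_mem_Icc_of_logRampDensity_ne_zero hε hb hy).2) Metric.isClosed_closedBall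

theorem hasCompactSupport_logRampDensity (hε : 0 < ε) (hb : 0 < b) :
    HasCompactSupport (logRampDensity z ε b) :=
  (isCompact_closedBall z _).of_isClosed_subset (isClosed_tsupport _)
    (tsupport_logRampDensity_subset hε hb)

/-- The density is a smoothed circle measure of mass `2π`, supported strictly inside the ball, so it
evaluates harmonic functions at the centre. -/
theorem integral_logRampDensity_mul (hε : 0 < ε) (hb : 0 < b) {H : ℂ → ℝ}
    (hH : InnerProductSpace.HarmonicOnNhd H (Metric.ball z ε)) :
    ∫ y, logRampDensity z ε b y * H y = 2 * Real.pi * H z := by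
  have hr₁ : 0 < ε * Real.exp (-(2 * b)) := by positivity
  have hr₁₂ : ε * Real.exp (-(2 * b)) ≤ ε * Real.exp (-b) :=
    mul_le_mul_of_nonneg_left (Real.exp_le_exp.2 (by linarith)) hε.le
  set w : ℝ → ℝ := fun r => deriv (deriv (softRamp b)) (Real.log (r / ε) + 2 * b) / r ^ 2
  have hlog : ∀ r, 0 < r → HasDerivAt (fun r => Real.log (r / ε) + 2 * b) r⁻¹ r := by
    intro r hr
    have h := (((hasDerivAt_id r).div_const ε).log (div_pos hr hε).ne').add_const (2 * b)
    refine h.congr_deriv ?_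
    simp only [id]
    field_simp
  have hpos : ∀ r ∈ Set.Icc (ε * Real.exp (-(2 * b))) (ε * Real.exp (-b)), 0 < r :=
    fun r hr => hr₁.trans_le hr.1
  have hw : ContinuousOn w (Set.Icc (ε * Real.exp (-(2 * b))) (ε * Real.exp (-b))) := by
    refine ContinuousOn.div ?_ (by fun_prop) fun r hr => (pow_pos (hpos r hr) 2).ne'
    exact (softRamp.continuous_deriv_deriv b).comp_continuousOn
      fun r hr => (hlog r (hpos r hr)).continuousAt.continuousWithinAt
  have hw0 : ∀ r, 0 < r → r ∉ Set.Icc (ε * Real.exp (-(2 * b))) (ε * Real.exp (-b)) →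
      w r = 0 := by
    intro r hr hr'
    rcases lt_or_ge r (ε * Real.exp (-(2 * b))) with h | h
    · rw [← log_div_lt_iff hε hr] at h
      simp only [w]
      rw [softRamp.deriv_deriv_of_neg hb (by linarith), zero_div]
    · have h2 := not_le.1 fun h3 => hr' ⟨h, h3⟩
      have h' := not_le.1 (mt (log_div_le_iff hε hr).1 (not_le.2 h2))
      simp only [w]
      rw [softRamp.deriv_deriv_of_lt hb (by linarith), zero_div]
  have hmain := integral_radial_mul_harmonic hr₁ hr₁₂ (exp_neg_mul_lt hε hb) hw hw0 hH
  -- The integrand is the derivative of the ramp's slope along `log (r / ε) + 2b`, and that slope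
  -- rises from 0 to 1 across the annulus.
  have hint : ∫ r in (ε * Real.exp (-(2 * b)))..(ε * Real.exp (-b)), r * w r = 1 := by
    rw [intervalIntegral.integral_eq_sub_of_hasDerivAt
      (f := fun r => deriv (softRamp b) (Real.log (r / ε) + 2 * b))]
    · rw [mul_div_cancel_left₀ _ hε.ne', mul_div_cancel_left₀ _ hε.ne', Real.log_exp,
        Real.log_exp, softRamp.deriv_eq_one hb (by linarith),
        softRamp.deriv_eq_zero hb (by linarith), sub_zero]
    · intro r hr
      rw [Set.uIcc_of_le hr₁₂] at hr
      have hr0 := hpos r hr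
      refine ((softRamp.hasDerivAt_deriv b _).comp r (hlog r hr0)).congr_deriv ?_
      simp only [w]
      field_simp
    · refine ContinuousOn.intervalIntegrable ?_
      rw [Set.uIcc_of_le hr₁₂]
      exact continuousOn_id.mul hw
  rw [hint, mul_one] at hmain
  exact hmain

theorem integral_logRampDensity (hε : 0 < ε) (hb : 0 < b) :
    ∫ y, logRampDensity z ε b y = 2 * Real.pi := by
  simpa using integral_logRampDensity_mul (z := z) hε hb
    (InnerProductSpace.harmonicOnNhd_const (1 : ℝ))

/-- The constant `softRamp b (2 * b)` is the value of `logRamp` at radius `ε`. Beyond that radius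
the ramp has slope one and equality holds; inside it monotonicity suffices. -/
theorem logRamp_sub_le (hε : 0 < ε) (hb : 0 < b) (y : ℂ) :
    logRamp z ε b y - softRamp b (2 * b) ≤ Real.log (max ε ‖z - y‖ / ε) := by
  rw [norm_sub_rev]
  rcases lt_or_ge ‖y - z‖ ε with h | h
  · rw [max_eq_left h.le, div_self hε.ne', Real.log_one, sub_nonpos]
    by_cases hy : y = z
    · rw [logRamp, if_pos hy]
      exact softRamp.nonneg hb _
    · rw [logRamp_of_ne hy]
      refine softRamp.monotone b ?_
      have := (log_div_lt_iff hε (t := 0) (norm_pos_iff.2 (sub_ne_zero.2 hy))).2 (by simpa using h)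
      linarith
  · have hy : y ≠ z := by
      rintro rfl
      rw [sub_self, norm_zero] at h
      linarith
    rw [max_eq_right h, logRamp_of_ne hy]
    have h0 : 0 ≤ Real.log (‖y - z‖ / ε) := Real.log_nonneg ((one_le_div hε).2 h)
    rw [softRamp.sub_eq_of_le hb (by linarith) (by linarith)]
    linarith

theorem le_logRamp_sub (hε : 0 < ε) (hb : 0 < b) (y : ℂ) :
    Real.log (max ε ‖z - y‖ / ε) - 2 * b ≤ logRamp z ε b y - softRamp b (2 * b) := by
  rw [norm_sub_rev]
  rcases lt_or_ge ‖y - z‖ ε with h | h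
  · rw [max_eq_left h.le, div_self hε.ne', Real.log_one]
    have h1 : 0 ≤ logRamp z ε b y := by
      unfold logRamp
      split_ifs
      · exact le_rfl
      · exact softRamp.nonneg hb _
    linarith [softRamp.le_self hb (s := 2 * b) (by linarith)]
  · have hy : y ≠ z := by
      rintro rfl
      rw [sub_self, norm_zero] at h
      linarith
    rw [max_eq_right h, logRamp_of_ne hy]
    have h0 : 0 ≤ Real.log (‖y - z‖ / ε) := Real.log_nonneg ((one_le_div hε).2 h)
    rw [softRamp.sub_eq_of_le hb (by linarith) (by linarith)]
    linarith

/-- The ramp has slope at most one. This places `smoothGreen` below the untruncated Green's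
function, whence the compact support of `approxGreen`. -/
theorem log_le_logRamp_sub (hb : 0 < b) {y : ℂ} (hy : y ≠ z) :
    Real.log (‖y - z‖ / ε) ≤ logRamp z ε b y - softRamp b (2 * b) := by
  rw [logRamp_of_ne hy]
  rcases le_total (Real.log (‖y - z‖ / ε)) 0 with h | h
  · have := softRamp.sub_le_sub (a := b) (s := Real.log (‖y - z‖ / ε) + 2 * b) (t := 2 * b)
      (by linarith)
    linarith
  · rw [softRamp.sub_eq_of_le hb (by linarith) (by linarith)]
    linarith

end LogRamp

/-! ### Series of independent centred Gaussian variables -/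

section GaussianSeries

open scoped NNReal

variable {Ω : Type*} [MeasurableSpace Ω] {P : Measure Ω}
  {Y : ℕ → Ω → ℝ} {v : ℕ → ℝ≥0}

theorem hasLaw_sum_gaussian [IsProbabilityMeasure P] (hY : iIndepFun Y P)
    (hlaw : ∀ n, HasLaw (Y n) (gaussianReal 0 (v n)) P) (N : ℕ) :
    HasLaw (fun ω => ∑ n ∈ Finset.range N, Y n ω)
      (gaussianReal 0 (∑ n ∈ Finset.range N, v n)) P := by
  induction N with
  | zero =>
    simp only [Finset.range_zero, Finset.sum_empty, gaussianReal_zero_var]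
    exact ⟨aemeasurable_const, by simp⟩
  | succ N ih =>
    have hind : IndepFun (∑ n ∈ Finset.range N, Y n) (Y N) P :=
      hY.indepFun_finsetSum_of_notMem₀ (fun n => (hlaw n).aemeasurable) (by simp)
    have heq : (∑ n ∈ Finset.range N, Y n) = fun ω => ∑ n ∈ Finset.range N, Y n ω := by
      funext ω
      simp
    rw [heq] at hind
    simp only [Finset.sum_range_succ]
    refine ⟨ih.aemeasurable.add (hlaw N).aemeasurable, ?_⟩
    have := gaussianReal_add_gaussianReal_of_indepFun hind ih.map_eq (hlaw N).map_eq
    rw [add_zero] at this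
    exact this

theorem eLpNorm_one_le_of_hasLaw_gaussian {X : Ω → ℝ} {u : ℝ≥0}
    (hX : HasLaw X (gaussianReal 0 u) P) : eLpNorm X 1 P ≤ ENNReal.ofReal (1 + u) := by
  have h1 : eLpNorm X 1 P = eLpNorm id 1 (gaussianReal 0 u) := by
    rw [← hX.map_eq, eLpNorm_map_measure aestronglyMeasurable_id hX.aemeasurable]
    rfl
  have hsq : Integrable (fun x : ℝ => x ^ 2) (gaussianReal 0 u) :=
    (memLp_id_gaussianReal (μ := 0) (v := u) 2).integrable_sq
  have hvar : ∫ x, x ^ 2 ∂gaussianReal 0 u = u := by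
    have h := variance_of_integral_eq_zero (μ := gaussianReal 0 u) (X := id)
      aemeasurable_id (by simp)
    rw [variance_id_gaussianReal] at h
    exact h.symm
  have hint : Integrable (fun x : ℝ => 1 + x ^ 2) (gaussianReal 0 u) :=
    (integrable_const 1).add hsq
  rw [h1, eLpNorm_one_eq_lintegral_enorm]
  calc ∫⁻ x, ‖id x‖ₑ ∂gaussianReal 0 u ≤ ∫⁻ x, ENNReal.ofReal (1 + x ^ 2) ∂gaussianReal 0 u := by
        refine lintegral_mono fun x => ?_
        rw [Real.enorm_eq_ofReal_abs]
        refine ENNReal.ofReal_le_ofReal ?_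
        simp only [id]
        nlinarith [sq_nonneg (|x| - 1), sq_abs x, abs_nonneg x]
    _ = ENNReal.ofReal (1 + u) := by
        rw [← ofReal_integral_eq_lintegral_ofReal hint
          (Eventually.of_forall fun x => by positivity), integral_add (integrable_const 1) hsq,
          hvar]
        simp

/-- The partial sums form a martingale for the natural filtration, bounded in `L¹` because their
variances are bounded by `∑ v n`. -/
theorem ae_exists_tendsto_sum_gaussian [IsProbabilityMeasure P] (hY : iIndepFun Y P)
    (hlaw : ∀ n, HasLaw (Y n) (gaussianReal 0 (v n)) P) (hv : Summable v) :
    ∀ᵐ ω ∂P, ∃ l, Tendsto (fun N => ∑ n ∈ Finset.range N, Y n ω) atTop (𝓝 l) := by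
  have hae : ∀ n, Y n =ᵐ[P] (hlaw n).aemeasurable.mk (Y n) := fun n =>
    (hlaw n).aemeasurable.ae_eq_mk
  -- The natural filtration needs measurable versions of the variables.
  set Y' : ℕ → Ω → ℝ := fun n => (hlaw n).aemeasurable.mk (Y n)
  have hm : ∀ n, StronglyMeasurable (Y' n) := fun n =>
    (hlaw n).aemeasurable.measurable_mk.stronglyMeasurable
  have hY' : iIndepFun Y' P := hY.congr hae
  have hlaw' : ∀ n, HasLaw (Y' n) (gaussianReal 0 (v n)) P := fun n => (hlaw n).congr (hae n).symm
  -- The range is `N + 1` because the filtration at time `N` already contains `Y' N`; the shift is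
  -- undone at the end.
  set S : ℕ → Ω → ℝ := fun N ω => ∑ n ∈ Finset.range (N + 1), Y' n ω
  have hSlaw : ∀ N, HasLaw (S N) (gaussianReal 0 (∑ n ∈ Finset.range (N + 1), v n)) P := fun N =>
    hasLaw_sum_gaussian hY' hlaw' (N + 1)
  have hI : ∀ {X : Ω → ℝ} {u : ℝ≥0}, HasLaw X (gaussianReal 0 u) P → Integrable X P := by
    intro X u hX
    rw [← memLp_one_iff_integrable]
    exact ⟨hX.aemeasurable.aestronglyMeasurable,
      (eLpNorm_one_le_of_hasLaw_gaussian hX).trans_lt ENNReal.ofReal_lt_top⟩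
  have hmart : Martingale S (Filtration.natural Y' hm) P := by
    refine martingale_of_condExp_sub_eq_zero_nat ?_ (fun N => hI (hSlaw N)) ?_
    · intro N
      refine Finset.stronglyMeasurable_fun_sum _ fun n hn => ?_
      exact (Filtration.stronglyAdapted_natural hm n).mono
        ((Filtration.natural Y' hm).mono (Nat.lt_succ_iff.1 (Finset.mem_range.1 hn)))
    · intro N
      have h1 : S (N + 1) - S N = Y' (N + 1) := by
        funext ω
        simp only [S, Pi.sub_apply]
        rw [Finset.sum_range_succ _ (N + 1)]
        ring
      rw [h1]
      refine (hY'.condExp_natural_ae_eq_of_lt hm (Nat.lt_succ_self N)).trans ?_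
      rw [(hlaw' (N + 1)).integral_eq, integral_id_gaussianReal]
      rfl
  have hbdd : ∀ N, eLpNorm (S N) 1 P ≤ ((1 + ∑' n, v n : ℝ≥0) : ENNReal) := by
    intro N
    refine (eLpNorm_one_le_of_hasLaw_gaussian (hSlaw N)).trans ?_
    rw [show (1 + ((∑ n ∈ Finset.range (N + 1), v n : ℝ≥0) : ℝ)) =
      ((1 + ∑ n ∈ Finset.range (N + 1), v n : ℝ≥0) : ℝ) by push_cast; rfl,
      ENNReal.ofReal_coe_nnreal]
    exact ENNReal.coe_le_coe.2 (by gcongr; exact hv.sum_le_tsum _ (by simp))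
  filter_upwards [hmart.submartingale.exists_ae_tendsto_of_bdd hbdd, ae_all_iff.2 hae] with ω hω hω'
  obtain ⟨l, hl⟩ := hω
  refine ⟨l, (tendsto_add_atTop_iff_nat 1).1 ?_⟩
  exact hl.congr fun N => Finset.sum_congr rfl fun n _ => (hω' n).symm

/-- Characteristic functions of the partial sums converge to that of `Z` by dominated convergence,
and to the Gaussian one by continuity in the variance. -/
theorem hasLaw_gaussian_of_tendsto_sum [IsProbabilityMeasure P] (hY : iIndepFun Y P)
    (hlaw : ∀ n, HasLaw (Y n) (gaussianReal 0 (v n)) P) (hv : Summable v) {Z : Ω → ℝ}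
    (hZ : ∀ᵐ ω ∂P, Tendsto (fun N => ∑ n ∈ Finset.range N, Y n ω) atTop (𝓝 (Z ω))) :
    HasLaw Z (gaussianReal 0 (∑' n, v n)) P := by
  have hSlaw := hasLaw_sum_gaussian hY hlaw
  have hZm : AEMeasurable Z P :=
    aemeasurable_of_tendsto_metrizable_ae atTop (fun N => (hSlaw N).aemeasurable) hZ
  refine ⟨hZm, ?_⟩
  have := Measure.isProbabilityMeasure_map hZm
  refine Measure.ext_of_charFun (funext fun t => ?_)
  have hchar : ∀ {X : Ω → ℝ}, AEMeasurable X P →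
      charFun (P.map X) t = ∫ ω, Complex.exp (t * X ω * Complex.I) ∂P := by
    intro X hX
    rw [charFun_apply_real, integral_map hX]
    exact (Continuous.aestronglyMeasurable (by fun_prop))
  have h1 : Tendsto (fun N => charFun (P.map fun ω => ∑ n ∈ Finset.range N, Y n ω) t) atTop
      (𝓝 (charFun (P.map Z) t)) := by
    simp only [hchar hZm, fun N => hchar (hSlaw N).aemeasurable]
    refine tendsto_integral_of_dominated_convergence (fun _ => 1) ?_ (integrable_const 1) ?_ ?_
    · intro N
      have hc : Continuous fun x : ℝ => Complex.exp (t * x * Complex.I) := by fun_prop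
      exact (hc.measurable.comp_aemeasurable (hSlaw N).aemeasurable).aestronglyMeasurable
    · intro N
      refine Eventually.of_forall fun ω => ?_
      rw [← Complex.ofReal_mul, Complex.norm_exp_ofReal_mul_I]
    · filter_upwards [hZ] with ω hω
      have hc : Continuous fun x : ℝ => Complex.exp (t * x * Complex.I) := by fun_prop
      exact (hc.tendsto _).comp hω
  have h2 : Tendsto (fun N => charFun (P.map fun ω => ∑ n ∈ Finset.range N, Y n ω) t) atTop
      (𝓝 (charFun (gaussianReal 0 (∑' n, v n)) t)) := by
    simp only [fun N => (hSlaw N).map_eq, charFun_gaussianReal]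
    have hc : Continuous fun x : ℝ≥0 =>
        Complex.exp (t * (0 : ℝ) * Complex.I - (x : ℝ) * t ^ 2 / 2) := by fun_prop
    exact (hc.tendsto _).comp hv.hasSum.tendsto_sum_nat
  exact tendsto_nhds_unique h1 h2

end GaussianSeries

/-! ### The pairing as a Gaussian variable with variance `‖f‖²`. -/

namespace GFF

variable {D : Opens ℂ} {Ω : Type*} [MeasurableSpace Ω] {P : Measure Ω}

theorem iIndepFun_coeff_mul (h : GFF D P) (f : H1 D) :
    iIndepFun (fun n ω => h.coeff n ω * h.basis.repr f n) P :=
  h.indep.comp (fun n x => x * h.basis.repr f n) fun _ => by fun_prop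

theorem hasLaw_coeff_mul (h : GFF D P) (f : H1 D) (n : ℕ) :
    HasLaw (fun ω => h.coeff n ω * h.basis.repr f n)
      (gaussianReal 0 (‖h.basis.repr f n‖₊ ^ 2)) P := by
  have := gaussianReal_mul_const (h.law n) (h.basis.repr f n)
  convert this using 2
  · simp
  · ext
    simp

theorem summable_nnnorm_repr_sq (h : GFF D P) (f : H1 D) :
    Summable fun n => ‖h.basis.repr f n‖₊ ^ 2 := by
  have := (lp.memℓp (h.basis.repr f)).summable (by simp)
  rw [← NNReal.summable_coe]
  simpa using this

theorem tsum_nnnorm_repr_sq (h : GFF D P) (f : H1 D) :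
    ((∑' n, ‖h.basis.repr f n‖₊ ^ 2 : NNReal) : ℝ) = ‖f‖ ^ 2 := by
  have h1 := lp.norm_rpow_eq_tsum (p := 2) (by simp) (h.basis.repr f)
  rw [LinearIsometryEquiv.norm_map] at h1
  rw [NNReal.coe_tsum]
  simpa using h1.symm

theorem ae_tendsto_pairing [IsProbabilityMeasure P] (h : GFF D P) (f : H1 D) :
    ∀ᵐ ω ∂P, Tendsto (fun N => h.partialPairing f N ω) atTop (𝓝 (h.pairing f ω)) := by
  filter_upwards [ae_exists_tendsto_sum_gaussian (h.iIndepFun_coeff_mul f) (h.hasLaw_coeff_mul f)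
    (h.summable_nnnorm_repr_sq f)] with ω hω
  exact tendsto_nhds_limUnder hω

theorem hasLaw_pairing [IsProbabilityMeasure P] (h : GFF D P) (f : H1 D) :
    HasLaw (h.pairing f) (gaussianReal 0 (∑' n, ‖h.basis.repr f n‖₊ ^ 2)) P :=
  hasLaw_gaussian_of_tendsto_sum (h.iIndepFun_coeff_mul f) (h.hasLaw_coeff_mul f)
    (h.summable_nnnorm_repr_sq f) (h.ae_tendsto_pairing f)

theorem memLp_pairing [IsProbabilityMeasure P] (h : GFF D P) (f : H1 D) :
    MemLp (h.pairing f) 2 P := by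
  have hl := h.hasLaw_pairing f
  have := memLp_id_gaussianReal (μ := 0) (v := ∑' n, ‖h.basis.repr f n‖₊ ^ 2) 2
  rw [← hl.map_eq] at this
  exact this.comp_of_map hl.aemeasurable

theorem variance_pairing [IsProbabilityMeasure P] (h : GFF D P) (f : H1 D) :
    variance (h.pairing f) P = ‖f‖ ^ 2 := by
  rw [(h.hasLaw_pairing f).variance_eq, variance_id_gaussianReal, tsum_nnnorm_repr_sq]

end GFF

/-! ### Approximation of the regularized Green's function by test functions -/

theorem continuous_mul_of_tsupport_subset {U : Set ℂ} (hU : IsOpen U) {u v : ℂ → ℝ}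
    (hu : ContinuousOn u U) (hv : Continuous v) (h : tsupport v ⊆ U) :
    Continuous fun y => u y * v y := by
  refine continuous_of_tsupport fun y hy => ?_
  have hyU : y ∈ U := h (tsupport_mul_subset_right hy)
  exact (hu.continuousAt (hU.mem_nhds hyU)).mul hv.continuousAt

/-- `H` is the harmonic correction of a Green's function `H y - log |y - z|` of `D` with pole
`z`. -/
structure IsCorrection (D : Opens ℂ) (z : ℂ) (H : ℂ → ℝ) : Prop where
  mem : z ∈ D
  harmonic : InnerProductSpace.HarmonicOnNhd H D
  nonneg : ∀ y ∈ D, y ≠ z → 0 ≤ H y - Real.log ‖y - z‖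
  small : ∀ a > 0, ∃ K, IsCompact K ∧ K ⊆ (D : Set ℂ) ∧ z ∈ K ∧
    ∀ y ∈ D, y ∉ K → H y - Real.log ‖y - z‖ < a

/-- The truncation at level `ε` of the Green's function with correction `H`. -/
def truncGreen (H : ℂ → ℝ) (ε : ℝ) (z y : ℂ) : ℝ := Real.log (1 / max ε ‖z - y‖) + H y

/-- A smooth version of `truncGreen`. -/
def smoothGreen (H : ℂ → ℝ) (ε : ℝ) (z : ℂ) (b : ℝ) (y : ℂ) : ℝ :=
  H y - Real.log ε - (logRamp z ε b y - softRamp b (2 * b))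

open Classical in
/-- A smooth and compactly supported version of `truncGreen`. -/
def approxGreen (D : Opens ℂ) (H : ℂ → ℝ) (ε : ℝ) (z : ℂ) (b : ℝ) (y : ℂ) : ℝ :=
  if y ∈ D then softRamp b (smoothGreen H ε z b y - b) else 0

theorem truncGreen_eq {H : ℂ → ℝ} {ε : ℝ} (hε : 0 < ε) (z y : ℂ) :
    truncGreen H ε z y = H y - Real.log ε - Real.log (max ε ‖z - y‖ / ε) := by
  have : 0 < max ε ‖z - y‖ := lt_max_of_lt_left hε
  rw [truncGreen, one_div, Real.log_inv, Real.log_div this.ne' hε.ne']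
  ring

theorem truncGreen_of_norm_le {H : ℂ → ℝ} {ε : ℝ} {z y : ℂ} (hy : ‖y - z‖ ≤ ε) :
    truncGreen H ε z y = H y - Real.log ε := by
  rw [truncGreen, norm_sub_rev, max_eq_left hy, one_div, Real.log_inv]
  ring

theorem truncGreen_of_le_norm {H : ℂ → ℝ} {ε : ℝ} {z y : ℂ} (hy : ε ≤ ‖y - z‖) :
    truncGreen H ε z y = H y - Real.log ‖y - z‖ := by
  rw [truncGreen, norm_sub_rev, max_eq_right hy, one_div, Real.log_inv]
  ring

namespace IsCorrection

variable {D : Opens ℂ} {z : ℂ} {H : ℂ → ℝ} {ε b : ℝ}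

/-- Outside the ball this is the Green's function. Inside it is `H - log ε`, harmonic, and bounded
below by `log (|y - z| / ε)`, which tends to 0 at the circle; the maximum principle concludes even
if the circle meets the boundary of `D`. -/
theorem truncGreen_nonneg (hH : IsCorrection D z H) (hε : 0 < ε)
    (hball : Metric.ball z ε ⊆ D) {y : ℂ} (hy : y ∈ D) : 0 ≤ truncGreen H ε z y := by
  rcases lt_or_ge ‖y - z‖ ε with h | h
  · rw [truncGreen_of_norm_le h.le]
    have hu : InnerProductSpace.HarmonicOnNhd (fun y => Real.log ε - H y) (Metric.ball z ε) :=
      (InnerProductSpace.harmonicOnNhd_const (Real.log ε)).sub (hH.harmonic.mono hball)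
    have hneg := nonpos_of_harmonicOnNhd Metric.isOpen_ball hu ?_ y (mem_ball_iff_norm.2 h)
    · linarith
    · intro δ hδ
      refine ⟨Metric.closedBall z (ε * Real.exp (-δ)), isCompact_closedBall _ _,
        Metric.closedBall_subset_ball (exp_neg_mul_lt hε hδ), fun w hw hδw => ?_⟩
      rw [mem_closedBall_iff_norm]
      by_cases hwz : w = z
      · rw [hwz, sub_self, norm_zero]
        positivity
      · rw [← log_div_le_iff hε (norm_pos_iff.2 (sub_ne_zero.2 hwz)), log_norm_sub_div_eq hε hwz]
        have := hH.nonneg w (hball hw) hwz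
        linarith
  · rw [truncGreen_of_le_norm h]
    refine hH.nonneg y hy ?_
    rintro rfl
    rw [sub_self, norm_zero] at h
    linarith

theorem truncGreen_le_smoothGreen (hε : 0 < ε) (hb : 0 < b) (y : ℂ) :
    truncGreen H ε z y ≤ smoothGreen H ε z b y := by
  rw [truncGreen_eq hε, smoothGreen]
  linarith [logRamp_sub_le (z := z) hε hb y]

theorem smoothGreen_le_truncGreen_add (hε : 0 < ε) (hb : 0 < b) (y : ℂ) :
    smoothGreen H ε z b y ≤ truncGreen H ε z y + 2 * b := by
  rw [truncGreen_eq hε, smoothGreen]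
  linarith [le_logRamp_sub (z := z) hε hb y]

theorem smoothGreen_le (hε : 0 < ε) (hb : 0 < b) {y : ℂ} (hy : y ≠ z) :
    smoothGreen H ε z b y ≤ H y - Real.log ‖y - z‖ := by
  have := log_le_logRamp_sub (ε := ε) hb hy
  rw [log_norm_sub_div_eq hε hy] at this
  rw [smoothGreen]
  linarith

theorem approxGreen_of_mem {y : ℂ} (hy : y ∈ D) :
    approxGreen D H ε z b y = softRamp b (smoothGreen H ε z b y - b) := if_pos hy

theorem approxGreen_nonneg (hb : 0 < b) (y : ℂ) : 0 ≤ approxGreen D H ε z b y := by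
  unfold approxGreen
  split_ifs
  · exact softRamp.nonneg hb _
  · exact le_rfl

/-- Smoothing adds between `0` and `2b`. The shift by `b` and the ramp together lower the value by
at most `2b`; where the ramp is zero, nonnegativity of `truncGreen` gives the upper bound. -/
theorem abs_approxGreen_sub_le (hH : IsCorrection D z H) (hε : 0 < ε)
    (hball : Metric.ball z ε ⊆ D) (hb : 0 < b) {y : ℂ} (hy : y ∈ D) :
    |approxGreen D H ε z b y - truncGreen H ε z y| ≤ 2 * b := by
  rw [approxGreen_of_mem hy]
  have h0 := hH.truncGreen_nonneg hε hball hy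
  have h1 := truncGreen_le_smoothGreen (H := H) (z := z) hε hb y
  have h2 := smoothGreen_le_truncGreen_add (H := H) (z := z) hε hb y
  have h3 := softRamp.sub_le_self hb (smoothGreen H ε z b y - b)
  rw [abs_le]
  refine ⟨by linarith, ?_⟩
  rcases le_total (smoothGreen H ε z b y - b) 0 with h | h
  · rw [softRamp.eq_zero hb h]
    linarith
  · linarith [softRamp.le_self hb h]

/-- Off a compact set the Green's function is below `b`, and so is `smoothGreen`: the shift by `b`
makes the argument of the ramp negative. -/
theorem exists_isCompact_approxGreen_eq_zero (hH : IsCorrection D z H) (hε : 0 < ε) (hb : 0 < b) :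
    ∃ K, IsCompact K ∧ K ⊆ (D : Set ℂ) ∧ ∀ y ∉ K, approxGreen D H ε z b y = 0 := by
  obtain ⟨K, hK, hKD, hzK, hsmall⟩ := hH.small b hb
  refine ⟨K, hK, hKD, fun y hy => ?_⟩
  unfold approxGreen
  split_ifs with hyD
  · refine softRamp.eq_zero hb ?_
    have hyz : y ≠ z := fun h => hy (h ▸ hzK)
    linarith [smoothGreen_le (H := H) hε hb hyz, hsmall y hyD hy]
  · rfl

theorem contDiffAt_smoothGreen (hH : IsCorrection D z H) (hε : 0 < ε) (hb : 0 < b) {y : ℂ}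
    (hy : y ∈ D) : ContDiffAt ℝ (⊤ : ℕ∞) (smoothGreen H ε z b) y :=
  ((HarmonicAt.analyticAt (hH.harmonic y hy)).contDiffAt.sub
    contDiffAt_const).sub ((contDiff_logRamp hε hb).contDiffAt.sub contDiffAt_const)

theorem tsupport_approxGreen_subset (hH : IsCorrection D z H) (hε : 0 < ε) (hb : 0 < b) :
    tsupport (approxGreen D H ε z b) ⊆ D := by
  obtain ⟨K, hK, hKD, h0⟩ := hH.exists_isCompact_approxGreen_eq_zero hε hb
  exact (closure_minimal (Function.support_subset_iff'.2 h0) hK.isClosed).trans hKD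

theorem hasCompactSupport_approxGreen (hH : IsCorrection D z H) (hε : 0 < ε) (hb : 0 < b) :
    HasCompactSupport (approxGreen D H ε z b) := by
  obtain ⟨K, hK, -, h0⟩ := hH.exists_isCompact_approxGreen_eq_zero hε hb
  exact HasCompactSupport.intro hK h0

theorem approxGreen_eventuallyEq {y : ℂ} (hy : y ∈ D) :
    approxGreen D H ε z b =ᶠ[𝓝 y] fun w => softRamp b (smoothGreen H ε z b w + -b) := by
  filter_upwards [D.isOpen.mem_nhds hy] with w hw
  rw [approxGreen_of_mem hw, sub_eq_add_neg]

theorem contDiff_approxGreen (hH : IsCorrection D z H) (hε : 0 < ε) (hb : 0 < b) :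
    ContDiff ℝ (⊤ : ℕ∞) (approxGreen D H ε z b) := by
  rw [contDiff_iff_contDiffAt]
  intro y
  by_cases hy : y ∈ D
  · refine ContDiffAt.congr_of_eventuallyEq ?_ (approxGreen_eventuallyEq hy)
    exact (softRamp.contDiff b).contDiffAt.comp y
      ((hH.contDiffAt_smoothGreen hε hb hy).add contDiffAt_const)
  · have : approxGreen D H ε z b =ᶠ[𝓝 y] fun _ => 0 :=
      notMem_tsupport_iff_eventuallyEq.1 fun h => hy (hH.tsupport_approxGreen_subset hε hb h)
    exact contDiffAt_const.congr_of_eventuallyEq this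

/-- `approxGreen` as a test function. -/
def testFunction (hH : IsCorrection D z H) (hε : 0 < ε) (hb : 0 < b) : 𝓓(D, ℝ) where
  toFun := approxGreen D H ε z b
  contDiff' := hH.contDiff_approxGreen hε hb
  hasCompactSupport' := hH.hasCompactSupport_approxGreen hε hb
  tsupport_subset' := hH.tsupport_approxGreen_subset hε hb

theorem laplacian_smoothGreen (hH : IsCorrection D z H) (hε : 0 < ε) (hb : 0 < b) {y : ℂ}
    (hy : y ∈ D) : laplacian (smoothGreen H ε z b) y = -logRampDensity z ε b y := by
  have h1 : ContDiffAt ℝ 2 (fun y => H y - (Real.log ε - softRamp b (2 * b))) y :=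
    (hH.harmonic y hy).1.sub contDiffAt_const
  have h1' : laplacian (fun y => H y - (Real.log ε - softRamp b (2 * b))) y = 0 := by
    have : InnerProductSpace.HarmonicAt
        (fun y => H y - (Real.log ε - softRamp b (2 * b))) y :=
      (hH.harmonic y hy).sub (InnerProductSpace.harmonicAt_const _)
    exact this.2.eq_of_nhds
  have h2 : ContDiffAt ℝ 2 (logRamp z ε b) y :=
    ((contDiff_logRamp hε hb).of_le two_le_infty).contDiffAt
  have h3 : smoothGreen H ε z b =
      (fun y => H y - (Real.log ε - softRamp b (2 * b))) - logRamp z ε b := by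
    funext y
    simp only [smoothGreen, Pi.sub_apply]
    ring
  rw [h3, h1.laplacian_sub h2, h1', laplacian_logRamp hε hb, zero_sub]

theorem laplacian_approxGreen (hH : IsCorrection D z H) (hε : 0 < ε) (hb : 0 < b) {y : ℂ}
    (hy : y ∈ D) : laplacian (approxGreen D H ε z b) y =
      -(deriv (softRamp b) (smoothGreen H ε z b y - b) * logRampDensity z ε b y) +
        deriv (deriv (softRamp b)) (smoothGreen H ε z b y - b) *
          ‖gradient (smoothGreen H ε z b) y‖ ^ 2 := by
  have hc := (hH.contDiffAt_smoothGreen hε hb hy).of_le two_le_infty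
  have hc' : ContDiffAt ℝ 2 (fun w => smoothGreen H ε z b w + -b) y := hc.add contDiffAt_const
  have hlap : laplacian (fun w => smoothGreen H ε z b w + -b) y =
      laplacian (smoothGreen H ε z b) y := by
    refine (hc.laplacian_add (contDiffAt_const (c := -b))).trans ?_
    simp
  have hgrad : gradient (fun w => smoothGreen H ε z b w + -b) y =
      gradient (smoothGreen H ε z b) y := by
    simp only [gradient, fderiv_add_const]
  rw [(InnerProductSpace.laplacian_congr_nhds (approxGreen_eventuallyEq hy)).eq_of_nhds,
    laplacian_comp ((softRamp.contDiff b).of_le two_le_infty) hc', hlap, hgrad,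
    hH.laplacian_smoothGreen hε hb hy, ← sub_eq_add_neg, mul_neg]

theorem tsupport_logRampDensity_subset_domain (hε : 0 < ε) (hball : Metric.ball z ε ⊆ D)
    (hb : 0 < b) : tsupport (logRampDensity z ε b) ⊆ D :=
  (tsupport_logRampDensity_subset hε hb).trans
    ((Metric.closedBall_subset_ball (exp_neg_mul_lt hε hb)).trans hball)

/-- Write `-Δφb = q - κ`, where `q` is the smoothed circle measure damped by the ramp's slope and `κ
≥ 0` comes from its convexity. Pairing `φa` with `q` gives `2π (H z - log ε)` up to `2π · 2(a + b)`.
Pairing it with `κ` costs as much again, since `φa ≤ 2(a + b)` where `κ` lives. -/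
theorem abs_integral_add_le (hH : IsCorrection D z H) (hε : 0 < ε)
    (hball : Metric.ball z ε ⊆ D) {a : ℝ} (ha : 0 < a) (hb : 0 < b) :
    |(-∫ y, approxGreen D H ε z a y * laplacian (approxGreen D H ε z b) y) -
      2 * Real.pi * (H z - Real.log ε)| ≤ 2 * Real.pi * (4 * (a + b)) := by
  set ν := logRampDensity z ε b with hν
  set φa := approxGreen D H ε z a
  set φb := approxGreen D H ε z b
  set q : ℂ → ℝ := fun y => deriv (softRamp b) (smoothGreen H ε z b y - b) * ν y with hq
  set κ : ℂ → ℝ := fun y => laplacian φb y + q y with hκ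
  have hνD : tsupport ν ⊆ D := tsupport_logRampDensity_subset_domain hε hball hb
  have hνc : Continuous ν := continuous_logRampDensity hε hb
  have hνs : HasCompactSupport ν := hasCompactSupport_logRampDensity hε hb
  have hν0 : ∀ y, 0 ≤ ν y := logRampDensity_nonneg hb
  have hνi : Integrable ν := hνc.integrable_of_hasCompactSupport hνs
  have hac : Continuous φa := (hH.contDiff_approxGreen hε ha).continuous
  have hφb := (hH.contDiff_approxGreen hε hb).of_le two_le_infty
  have hφbs := hH.hasCompactSupport_approxGreen hε hb
  have hLc : Continuous (laplacian φb) := continuous_laplacian hφb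
  have hLs : HasCompactSupport (laplacian φb) :=
    hφbs.mono' ((subset_tsupport _).trans (tsupport_laplacian_subset φb))
  have hLi : Integrable (laplacian φb) := hLc.integrable_of_hasCompactSupport hLs
  have hqc : Continuous q := by
    refine continuous_mul_of_tsupport_subset D.isOpen (fun y hy => ?_) hνc hνD
    have h1 := ((hH.contDiffAt_smoothGreen hε hb hy).continuousAt).sub
      (continuousAt_const (y := b))
    exact (((softRamp.contDiff_deriv b).continuous.continuousAt).comp h1).continuousWithinAt
  have hqs : HasCompactSupport q := hνs.mul_left
  have hqi : Integrable q := hqc.integrable_of_hasCompactSupport hqs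
  have hκc : Continuous κ := hLc.add hqc
  have hκi : Integrable κ := hLi.add hqi
  have hq0 : ∀ y, 0 ≤ q y := fun y => mul_nonneg (softRamp.deriv_nonneg _) (hν0 y)
  have hqν : ∀ y, q y ≤ ν y := fun y =>
    mul_le_of_le_one_left (hν0 y) (softRamp.deriv_le_one _)
  have hκD : ∀ y ∈ D, κ y = deriv (deriv (softRamp b)) (smoothGreen H ε z b y - b) *
      ‖gradient (smoothGreen H ε z b) y‖ ^ 2 := by
    intro y hy
    simp only [hκ, hq, φb, hν]
    rw [hH.laplacian_approxGreen hε hb hy]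
    ring
  have hκoff : ∀ y ∉ D, κ y = 0 := by
    intro y hy
    have h1 : laplacian φb y = 0 := image_eq_zero_of_notMem_tsupport fun h =>
      hy (hH.tsupport_approxGreen_subset hε hb (tsupport_laplacian_subset φb h))
    have h2 : ν y = 0 := image_eq_zero_of_notMem_tsupport fun h => hy (hνD h)
    simp only [hκ, hq, h1, h2, mul_zero, add_zero]
  have hκ0 : ∀ y, 0 ≤ κ y := by
    intro y
    by_cases hy : y ∈ D
    · rw [hκD y hy]
      exact mul_nonneg (softRamp.deriv_deriv_nonneg hb _) (by positivity)
    · exact (hκoff y hy).ge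
  have hsmall : ∀ y ∈ D, smoothGreen H ε z b y ≤ 2 * b → φa y ≤ 2 * (a + b) := by
    intro y hy h
    have h1 := (abs_le.1 (hH.abs_approxGreen_sub_le hε hball ha hy)).2
    have h2 := truncGreen_le_smoothGreen (H := H) (z := z) hε hb y
    linarith
  have ha0 : ∀ y, 0 ≤ φa y := approxGreen_nonneg ha
  have hφκ : ∀ y, φa y * κ y ≤ 2 * (a + b) * κ y := by
    intro y
    by_cases hy : y ∈ D
    · rcases le_or_gt (smoothGreen H ε z b y) (2 * b) with h | h
      · exact mul_le_mul_of_nonneg_right (hsmall y hy h) (hκ0 y)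
      · rw [hκD y hy, softRamp.deriv_deriv_of_lt hb (by linarith)]
        simp
    · rw [hκoff y hy, mul_zero, mul_zero]
  set F : ℂ → ℝ := fun y => H y - Real.log ε with hF
  have hFν : ∫ y, ν y * F y = 2 * Real.pi * (H z - Real.log ε) :=
    integral_logRampDensity_mul hε hb ((hH.harmonic.mono hball).sub
      (InnerProductSpace.harmonicOnNhd_const (Real.log ε)))
  have hFc : Continuous fun y => F y * ν y :=
    continuous_mul_of_tsupport_subset D.isOpen (hH.harmonic.continuousOn.sub continuousOn_const)
      hνc hνD
  have hFi : Integrable fun y => F y * ν y :=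
    hFc.integrable_of_hasCompactSupport hνs.mul_left
  have hφq : Integrable fun y => φa y * q y :=
    (hac.mul hqc).integrable_of_hasCompactSupport hqs.mul_left
  have hφκi : Integrable fun y => φa y * κ y :=
    (hac.mul hκc).integrable_of_hasCompactSupport (hLs.add hqs).mul_left
  have hpt : ∀ y, |φa y * q y - F y * ν y| ≤ 2 * (a + b) * ν y := by
    intro y
    rcases eq_or_ne (ν y) 0 with h0 | h0
    · simp [hq, h0]
    · have hyb := norm_sub_mem_Icc_of_logRampDensity_ne_zero hε hb h0
      have hyε : ‖y - z‖ < ε := hyb.2.trans_lt (exp_neg_mul_lt hε hb)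
      have hyD : y ∈ D := hball (mem_ball_iff_norm.2 hyε)
      have hGF : truncGreen H ε z y = F y := truncGreen_of_norm_le hyε.le
      have h1 := abs_le.1 (hH.abs_approxGreen_sub_le hε hball ha hyD)
      have h2 := hH.truncGreen_nonneg hε hball hyD
      have h3 := truncGreen_le_smoothGreen (H := H) (z := z) hε hb y
      rw [hGF] at h1 h2 h3
      have hp := hν0 y
      -- Either both products are small, or the ramp has slope one and `q = ν`.
      rcases le_or_gt (smoothGreen H ε z b y) (2 * b) with h | h
      · have h4 := hsmall y hyD h
        have h5 : φa y * q y ≤ 2 * (a + b) * ν y :=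
          mul_le_mul h4 (hqν y) (hq0 y) (by linarith)
        have h6 : F y * ν y ≤ 2 * (a + b) * ν y :=
          mul_le_mul_of_nonneg_right (by linarith) hp
        have h7 : 0 ≤ φa y * q y := mul_nonneg (ha0 y) (hq0 y)
        have h8 : 0 ≤ F y * ν y := mul_nonneg h2 hp
        rw [abs_le]
        exact ⟨by linarith, by linarith⟩
      · have hq1 : q y = ν y := by
          simp only [hq]
          rw [softRamp.deriv_eq_one hb (by linarith), one_mul]
        rw [hq1, ← sub_mul, abs_mul, abs_of_nonneg hp]
        refine mul_le_mul_of_nonneg_right ?_ hp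
        rw [abs_le]
        exact ⟨by linarith [h1.1], by linarith [h1.2]⟩
  have hsplit : -∫ y, φa y * laplacian φb y = (∫ y, φa y * q y) - ∫ y, φa y * κ y := by
    rw [← integral_sub hφq hφκi, ← integral_neg]
    congr 1
    funext y
    simp only [hκ]
    ring
  -- The Laplacian of `φb` has integral zero, so `κ` has the same mass as `q ≤ ν`. No estimate of
  -- the gradient in `κ` is needed.
  have hκint : ∫ y, κ y ≤ 2 * Real.pi := by
    rw [integral_add hLi hqi, integral_laplacian_eq_zero hφb hφbs, zero_add,
      ← integral_logRampDensity (z := z) hε hb]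
    exact integral_mono hqi hνi hqν
  have hA : |(∫ y, φa y * q y) - ∫ y, F y * ν y| ≤ 2 * (a + b) * (2 * Real.pi) := by
    rw [← integral_sub hφq hFi, ← integral_logRampDensity (z := z) hε hb, ← integral_const_mul]
    exact norm_integral_le_of_norm_le (f := fun y => φa y * q y - F y * ν y)
      (hνi.const_mul (2 * (a + b))) (Eventually.of_forall hpt)
  have hB0 : 0 ≤ ∫ y, φa y * κ y := integral_nonneg fun y => mul_nonneg (ha0 y) (hκ0 y)
  have hB : ∫ y, φa y * κ y ≤ 2 * (a + b) * (2 * Real.pi) :=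
    calc ∫ y, φa y * κ y ≤ ∫ y, 2 * (a + b) * κ y := integral_mono hφκi (hκi.const_mul _) hφκ
      _ = 2 * (a + b) * ∫ y, κ y := integral_const_mul _ _
      _ ≤ 2 * (a + b) * (2 * Real.pi) := mul_le_mul_of_nonneg_left hκint (by linarith)
  have hFν' : ∫ y, F y * ν y = 2 * Real.pi * (H z - Real.log ε) := by
    rw [← hFν]
    simp only [mul_comm]
  rw [hsplit, ← hFν']
  have := abs_le.1 hA
  rw [abs_le]
  constructor <;> linarith [this.1, this.2]

end IsCorrection

/-! ### The Dirichlet inner product -/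

theorem inner_gradL2 {D : Opens ℂ} (f g : 𝓓(D, ℝ)) :
    inner ℝ (gradL2 D f) (gradL2 D g) =
      (2 * Real.pi)⁻¹ * -∫ y, f y * laplacian (g : ℂ → ℝ) y := by
  have h0 : ∀ y ∉ (D : Set ℂ), inner ℝ (gradient (f : ℂ → ℝ) y) (gradient (g : ℂ → ℝ) y) = 0 := by
    intro y hy
    have h1 : fderiv ℝ (f : ℂ → ℝ) y = 0 := image_eq_zero_of_notMem_tsupport fun h =>
      hy (f.tsupport_subset (tsupport_fderiv_subset ℝ h))
    simp [gradient, h1]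
  have hpi : (0 : ℝ) ≤ (2 * Real.pi)⁻¹ := by positivity
  rw [← integral_inner_gradient (f.contDiff.of_le (by exact_mod_cast le_top))
    (g.contDiff.of_le two_le_infty) g.hasCompactSupport, L2.inner_def,
    ← setIntegral_eq_integral_of_forall_compl_eq_zero h0]
  calc ∫ y, inner ℝ (gradL2 D f y) (gradL2 D g y) ∂dirichletMeasure D
      = ∫ y, inner ℝ (gradient (f : ℂ → ℝ) y) (gradient (g : ℂ → ℝ) y) ∂dirichletMeasure D := by
        refine integral_congr_ae ?_
        filter_upwards [(memLp_gradient D f).coeFn_toLp, (memLp_gradient D g).coeFn_toLp]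
          with y hf hg
        exact congrArg₂ (inner ℝ) hf hg
    _ = _ := by
        rw [dirichletMeasure, integral_smul_measure, ENNReal.toReal_ofReal hpi, smul_eq_mul]

/-- Integration by parts moves both derivatives onto `g`. Its Laplacian is bounded with compact
support in `D`, so `L¹` convergence on compacts is enough. -/
theorem inner_gradL2_eq_zero_of_tendsto {D : Opens ℂ} {d : ℕ → 𝓓(D, ℝ)}
    {w : Lp ℂ 2 (dirichletMeasure D)} (hw : Tendsto (fun n => gradL2 D (d n)) atTop (𝓝 w))
    (hd : ∀ K : Set ℂ, IsCompact K → K ⊆ D →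
      Tendsto (fun n => ∫⁻ x in K, ‖d n x‖ₑ) atTop (𝓝 0)) (g : 𝓓(D, ℝ)) :
    inner ℝ w (gradL2 D g) = 0 := by
  have h1 : Tendsto (fun n => inner ℝ (gradL2 D (d n)) (gradL2 D g)) atTop
      (𝓝 (inner ℝ w (gradL2 D g))) := hw.inner tendsto_const_nhds
  refine tendsto_nhds_unique h1 ?_
  have hLc : Continuous (laplacian (g : ℂ → ℝ)) :=
    continuous_laplacian (g.contDiff.of_le two_le_infty)
  have hLK := tsupport_laplacian_subset (g : ℂ → ℝ)
  obtain ⟨M, hM⟩ := hLc.bounded_above_of_compact_support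
    (g.hasCompactSupport.mono' ((subset_tsupport _).trans hLK))
  have hM0 : 0 ≤ M := (norm_nonneg _).trans (hM 0)
  set K := tsupport (g : ℂ → ℝ)
  have hK : IsCompact K := g.hasCompactSupport
  have h2 : ∀ n, ‖∫ y, d n y * laplacian (g : ℂ → ℝ) y‖ₑ ≤
      (∫⁻ y in K, ‖d n y‖ₑ) * ENNReal.ofReal M := by
    intro n
    rw [← setIntegral_eq_integral_of_forall_compl_eq_zero (s := K) (fun y hy => by
      rw [image_eq_zero_of_notMem_tsupport fun h => hy (hLK h), mul_zero])]
    refine (enorm_integral_le_lintegral_enorm _).trans ?_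
    rw [← lintegral_mul_const' _ _ ENNReal.ofReal_ne_top]
    refine lintegral_mono fun y => ?_
    rw [enorm_mul]
    gcongr
    rw [← ofReal_norm]
    exact ENNReal.ofReal_le_ofReal (hM y)
  have h3 : Tendsto (fun n => (∫⁻ y in K, ‖d n y‖ₑ) * ENNReal.ofReal M) atTop (𝓝 0) := by
    have := ENNReal.Tendsto.mul_const (hd K hK g.tsupport_subset)
      (Or.inr ENNReal.ofReal_ne_top : (0 : ENNReal) ≠ 0 ∨ ENNReal.ofReal M ≠ ⊤)
    rwa [zero_mul] at this
  have h4 : Tendsto (fun n => ∫ y, d n y * laplacian (g : ℂ → ℝ) y) atTop (𝓝 0) := by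
    rw [tendsto_zero_iff_enorm_tendsto_zero]
    exact tendsto_of_tendsto_of_tendsto_of_le_of_le tendsto_const_nhds h3 (fun _ => zero_le) h2
  simp only [inner_gradL2]
  simpa using h4.neg.const_mul (2 * Real.pi)⁻¹

/-- A continuous function represents at most one element of `H¹₀(D)`. -/
theorem Represents.unique {D : Opens ℂ} {u u' : H1 D} {f : ℂ → ℝ} (hf : ContinuousOn f D)
    (hu : Represents u f) (hu' : Represents u' f) : u = u' := by
  obtain ⟨φ, hφ, hφf⟩ := hu
  obtain ⟨φ', hφ', hφf'⟩ := hu'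
  have hw : Tendsto (fun n => gradL2 D (φ n - φ' n)) atTop
      (𝓝 ((u - u' : H1 D) : Lp ℂ 2 (dirichletMeasure D))) := by
    simpa using hφ.sub hφ'
  have hd : ∀ K : Set ℂ, IsCompact K → K ⊆ D →
      Tendsto (fun n => ∫⁻ x in K, ‖(φ n - φ' n) x‖ₑ) atTop (𝓝 0) := by
    intro K hK hKD
    have hm : AEMeasurable f (volume.restrict K) :=
      (hf.mono hKD).aemeasurable hK.measurableSet
    have h1 : ∀ n, ∫⁻ x in K, ‖(φ n - φ' n) x‖ₑ ≤
        (∫⁻ x in K, ‖φ n x - f x‖ₑ) + ∫⁻ x in K, ‖φ' n x - f x‖ₑ := by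
      intro n
      have hme : AEMeasurable (fun x => ‖φ n x - f x‖ₑ) (volume.restrict K) :=
        ((φ n).continuous.measurable.aemeasurable.sub hm).enorm
      rw [← lintegral_add_left' hme]
      refine lintegral_mono fun x => ?_
      rw [show (φ n - φ' n) x = (φ n x - f x) - (φ' n x - f x) by
        rw [sub_sub_sub_cancel_right]; rfl]
      exact enorm_sub_le
    refine tendsto_of_tendsto_of_tendsto_of_le_of_le tendsto_const_nhds ?_ (fun _ => zero_le) h1
    simpa using (hφf K hK hKD).add (hφf' K hK hKD)
  -- The difference lies in the closure of the gradients and is orthogonal to them, hence zero.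
  have horth : ∀ v ∈ LinearMap.range (gradL2 D),
      inner ℝ ((u - u' : H1 D) : Lp ℂ 2 (dirichletMeasure D)) v = 0 := by
    rintro _ ⟨g, rfl⟩
    exact inner_gradL2_eq_zero_of_tendsto hw hd g
  have hmem : ((u - u' : H1 D) : Lp ℂ 2 (dirichletMeasure D)) ∈ (LinearMap.range (gradL2 D))ᗮ :=
    (Submodule.mem_orthogonal' _ _).2 horth
  rw [← Submodule.orthogonal_closure] at hmem
  have hz := Submodule.inner_right_of_mem_orthogonal (u - u' : H1 D).2 hmem
  rw [inner_self_eq_zero] at hz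
  exact sub_eq_zero.1 (Subtype.ext hz)

theorem Represents.toH1_eq {D : Opens ℂ} {u : H1 D} {f : ℂ → ℝ} (hf : ContinuousOn f D)
    (hu : Represents u f) : toH1 D f = u := by
  have h : MemH1 D f := ⟨u, hu⟩
  rw [toH1, dif_pos h]
  exact h.choose_spec.unique hf hu

/-- Vectors whose Gram matrix converges to a constant one form a convergent sequence. -/
theorem exists_tendsto_of_inner_tendsto {E : Type*} [NormedAddCommGroup E] [InnerProductSpace ℝ E]
    [CompleteSpace E] {x : ℕ → E} {a : ℕ → ℝ} {T : ℝ} (ha : Antitone a)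
    (ha0 : Tendsto a atTop (𝓝 0)) (hx : ∀ n m, |inner ℝ (x n) (x m) - T| ≤ a n + a m) :
    ∃ y, Tendsto x atTop (𝓝 y) ∧ ‖y‖ ^ 2 = T := by
  -- In the expansion of the square, `T` cancels as `T - 2T + T`; the errors add up to `2 a n + 2 (a
  -- n + a m) + 2 a m`.
  have hsq : ∀ n m, ‖x n - x m‖ ^ 2 ≤ 4 * (a n + a m) := by
    intro n m
    rw [norm_sub_sq_real, ← real_inner_self_eq_norm_sq, ← real_inner_self_eq_norm_sq]
    have h1 := abs_le.1 (hx n n)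
    have h2 := abs_le.1 (hx n m)
    have h3 := abs_le.1 (hx m m)
    linarith [h1.2, h2.1, h3.2]
  have hc : CauchySeq x := by
    refine cauchySeq_of_le_tendsto_0 (fun N => Real.sqrt (8 * a N)) (fun n m N hn hm => ?_) ?_
    · rw [dist_eq_norm]
      refine Real.le_sqrt_of_sq_le ((hsq n m).trans ?_)
      linarith [ha hn, ha hm]
    · have := (ha0.const_mul 8).sqrt
      simpa using this
  obtain ⟨y, hy⟩ := cauchySeq_tendsto_of_complete hc
  refine ⟨y, hy, tendsto_nhds_unique (hy.norm.pow 2) ?_⟩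
  have h : Tendsto (fun n => inner ℝ (x n) (x n) - T) atTop (𝓝 0) := by
    refine squeeze_zero_norm (fun n => hx n n) ?_
    simpa using ha0.add ha0
  simpa [real_inner_self_eq_norm_sq] using h.add_const T

/-! ### The truncated Green's function as an element of `H1 D`, and its norm. -/

namespace IsCorrection

variable {D : Opens ℂ} {z : ℂ} {H : ℂ → ℝ} {ε b : ℝ}

theorem abs_inner_gradL2_sub_le (hH : IsCorrection D z H) (hε : 0 < ε)
    (hball : Metric.ball z ε ⊆ D) {a : ℝ} (ha : 0 < a) (hb : 0 < b) :
    |inner ℝ (gradL2 D (hH.testFunction hε ha)) (gradL2 D (hH.testFunction hε hb)) -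
      (H z - Real.log ε)| ≤ 4 * a + 4 * b := by
  have h := hH.abs_integral_add_le hε hball ha hb
  have hpi := Real.pi_pos
  rw [inner_gradL2]
  change |(2 * Real.pi)⁻¹ *
    (-∫ y, approxGreen D H ε z a y * laplacian (approxGreen D H ε z b) y) - _| ≤ _
  set I := -∫ y, approxGreen D H ε z a y * laplacian (approxGreen D H ε z b) y
  have h1 : (2 * Real.pi)⁻¹ * I - (H z - Real.log ε) =
      (2 * Real.pi)⁻¹ * (I - 2 * Real.pi * (H z - Real.log ε)) := by
    field_simp
  rw [h1, abs_mul, abs_of_pos (by positivity), inv_mul_le_iff₀ (by positivity)]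
  linarith

theorem exists_represents (hH : IsCorrection D z H) (hε : 0 < ε)
    (hball : Metric.ball z ε ⊆ D) :
    ∃ u : H1 D, Represents u (truncGreen H ε z) ∧ ‖u‖ ^ 2 = H z - Real.log ε := by
  set a : ℕ → ℝ := fun n => 1 / ((n : ℝ) + 1)
  have ha : ∀ n, 0 < a n := fun n => by positivity
  have ha0 : Tendsto a atTop (𝓝 0) := tendsto_one_div_add_atTop_nhds_zero_nat
  have hanti : Antitone fun n => 4 * a n := fun n m hnm => by
    have := Nat.one_div_le_one_div (α := ℝ) hnm
    simp only [a]
    linarith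
  set φ : ℕ → 𝓓(D, ℝ) := fun n => hH.testFunction hε (ha n)
  obtain ⟨x, hx, hxT⟩ := exists_tendsto_of_inner_tendsto (x := fun n => gradL2 D (φ n))
    (a := fun n => 4 * a n) (T := H z - Real.log ε) hanti (by simpa using ha0.const_mul 4)
    (fun n m => hH.abs_inner_gradL2_sub_le hε hball (ha n) (ha m))
  have hxH : x ∈ H1 D := mem_closure_of_tendsto hx
    (Eventually.of_forall fun n => ⟨φ n, rfl⟩)
  refine ⟨⟨x, hxH⟩, ⟨φ, hx, fun K hK hKD => ?_⟩, hxT⟩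
  have h1 : ∀ n, ∫⁻ y in K, ‖φ n y - truncGreen H ε z y‖ₑ ≤
      ENNReal.ofReal (2 * a n) * volume K := by
    intro n
    rw [← setLIntegral_const]
    refine setLIntegral_mono_ae measurable_const.aemeasurable
      (Eventually.of_forall fun y hy => ?_)
    rw [← ofReal_norm]
    exact ENNReal.ofReal_le_ofReal (hH.abs_approxGreen_sub_le hε hball (ha n) (hKD hy))
  have h2 : Tendsto (fun n => ENNReal.ofReal (2 * a n) * volume K) atTop (𝓝 0) := by
    have h3 : Tendsto (fun n => ENNReal.ofReal (2 * a n)) atTop (𝓝 0) := by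
      have := ENNReal.tendsto_ofReal (ha0.const_mul 2)
      simpa using this
    have := ENNReal.Tendsto.mul_const h3
      (Or.inr hK.measure_ne_top : (0 : ENNReal) ≠ 0 ∨ volume K ≠ ⊤)
    rwa [zero_mul] at this
  exact tendsto_of_tendsto_of_tendsto_of_le_of_le tendsto_const_nhds h2 (fun _ => zero_le) h1

end IsCorrection

/-! ### From the conformal map to the hypotheses of the norm computation, and conclusion. -/

theorem IsCorrection.continuousOn_truncGreen {D : Opens ℂ} {z : ℂ} {H : ℂ → ℝ} {ε : ℝ}
    (hH : IsCorrection D z H) (hε : 0 < ε) : ContinuousOn (truncGreen H ε z) D := by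
  refine ContinuousOn.add (Continuous.continuousOn ?_) hH.harmonic.continuousOn
  have hpos : ∀ y : ℂ, max ε ‖z - y‖ ≠ 0 := fun y => (lt_max_of_lt_left hε).ne'
  exact Continuous.log (continuous_const.div (by fun_prop) hpos)
    fun y => one_div_ne_zero (hpos y)

theorem isCorrection_greenCorrection {D : Opens ℂ} {z : ℂ} {φ : ℂ → ℂ}
    (hφ : IsConformalMap φ D (Metric.ball 0 1)) (hz : z ∈ D) (hφz : φ z = 0) :
    IsCorrection D z (greenCorrection D z) := by
  have heq := greenCorrection_eqOn hφ hz hφz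
  have hG : ∀ y ∈ D, y ≠ z → greenCorrection D z y - Real.log ‖y - z‖ = -Real.log ‖φ y‖ := by
    intro y hy hyz
    rw [heq hy, log_norm_eq_add_log_dslope hφ hz hφz hy hyz]
    ring
  refine ⟨hz, fun y hy => ?_, fun y hy hyz => ?_, fun a ha => ?_⟩
  · refine (InnerProductSpace.harmonicAt_congr_nhds ?_).2 (harmonicOnNhd_log_dslope hφ hz hφz y hy)
    exact heq.eventuallyEq_of_mem (D.isOpen.mem_nhds hy)
  · rw [hG y hy hyz]
    exact neg_log_norm_nonneg hφ hy
  · have hr : Real.exp (-a) < 1 := Real.exp_lt_one_iff.2 (by linarith)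
    -- The radius `exp (-a)` is chosen so that `-log |φ| < a` exactly where `|φ| > exp (-a)`.
    refine ⟨D ∩ φ ⁻¹' Metric.closedBall 0 (Real.exp (-a)), hφ.isCompact_preimage D.isOpen
      (isCompact_closedBall _ _) (Metric.closedBall_subset_ball hr), Set.inter_subset_left,
      ⟨hz, ?_⟩, fun y hy hyK => ?_⟩
    · rw [Set.mem_preimage, hφz]
      exact Metric.mem_closedBall_self (Real.exp_pos _).le
    · have hlt : Real.exp (-a) < ‖φ y‖ := by
        by_contra! hle
        exact hyK ⟨hy, by simpa using hle⟩
      have hyz : y ≠ z := by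
        rintro rfl
        rw [hφz, norm_zero] at hlt
        exact absurd hlt (not_lt.2 (Real.exp_pos _).le)
      rw [hG y hy hyz]
      have := Real.log_lt_log (Real.exp_pos _) hlt
      rw [Real.log_exp] at this
      linarith

/-- The ball is connected, misses the frontier and meets the interior, so it cannot reach the
complement of the closure. -/
theorem ball_subset_of_le_infDist_frontier {U : Set ℂ} {z : ℂ} (hz : z ∈ U) {ε : ℝ} (hε : 0 < ε)
    (h : ε ≤ Metric.infDist z (frontier U)) : Metric.ball z ε ⊆ U := by
  have hdisj : ∀ x ∈ Metric.ball z ε, x ∉ frontier U := by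
    intro x hxb hxf
    have := h.trans (Metric.infDist_le_dist_of_mem hxf)
    rw [Metric.mem_ball, dist_comm] at hxb
    linarith
  have hint : ∀ x ∈ Metric.ball z ε, x ∈ closure U → x ∈ interior U := fun x hxb hxc =>
    by_contra fun hxi => hdisj x hxb ⟨hxc, hxi⟩
  refine ((convex_ball z ε).isPreconnected.subset_left_of_subset_union isOpen_interior
    isClosed_closure.isOpen_compl (Set.disjoint_left.2 fun x hx hx' => hx'
      (subset_closure (interior_subset hx))) (fun x hx => ?_)
    ⟨z, Metric.mem_ball_self hε, hint z (Metric.mem_ball_self hε) (subset_closure hz)⟩).trans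
      interior_subset
  by_cases hxc : x ∈ closure U
  · exact Or.inl (hint x hx hxc)
  · exact Or.inr hxc

end PlanarGFF

end

theorem lemmal {Ω : Type*} [MeasurableSpace Ω] (P : Measure Ω) [IsProbabilityMeasure P]
    (D : Opens ℂ) (h : PlanarGFF.GFF D P) (z : ℂ) (hz : z ∈ D)
    (C : ℝ) (hC : PlanarGFF.IsConformalRadius D z C)
    (ε : ℝ) (hε : 0 < ε) (hεD : ε ≤ Metric.infDist z (frontier (D : Set ℂ))) :
    PlanarGFF.MemH1 D (PlanarGFF.regGreen D ε z) ∧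
    (∀ᵐ ω ∂P, Tendsto
      (fun N => h.partialPairing (PlanarGFF.toH1 D (PlanarGFF.regGreen D ε z)) N ω)
      atTop (𝓝 (h.circleAvg ε z ω))) ∧
    MemLp (h.circleAvg ε z) 2 P ∧
    variance (h.circleAvg ε z) P = Real.log (1 / ε) + Real.log C := by
  obtain ⟨φ, hφ, hφz, rfl⟩ := hC
  have hH := PlanarGFF.isCorrection_greenCorrection hφ hz hφz
  obtain ⟨u, hu, hnorm⟩ := hH.exists_represents hε
    (PlanarGFF.ball_subset_of_le_infDist_frontier hz hε hεD)
  -- `regGreen` is by definition `truncGreen` with `H = greenCorrection D z`.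
  have hcont : ContinuousOn (PlanarGFF.regGreen D ε z) D := hH.continuousOn_truncGreen hε
  have hu' : PlanarGFF.Represents u (PlanarGFF.regGreen D ε z) := hu
  refine ⟨⟨u, hu'⟩, h.ae_tendsto_pairing _, h.memLp_pairing _, ?_⟩
  rw [PlanarGFF.GFF.circleAvg, h.variance_pairing, hu'.toH1_eq hcont, hnorm,
    PlanarGFF.greenCorrection_eqOn hφ hz hφz hz, one_div, Real.log_inv, Real.log_inv]
  beta_reduce
  rw [dslope_same]
  ring
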